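/- Let $G$ be a locally compact (Hausdorff) group with Fourier algebra $A(G)$ (the predual of the group von Neumann algebra $VN(G)$, realized as an algebra of functions on $G$ through $u(s)=\langle \lambda(s),u\rangle$, with pointwise product, the norm of the predual, and the operator space structure of the predual of $VN(G)$). A Segal algebra in $A(G)$ is a dense ideal $B$ of $A(G)$ with a norm $\|\cdot\|_B$ for which $B$ is complete, $\|ab\|_B\le\|a\|_{A(G)}\|b\|_B$ for $a\in A(G)$, $b\in B$, and $A(G)\cdot B$ has dense linear span in $B$. An operator Segal algebra in $A(G)$ is a Segal algebra whose norm is that of an operator space structure on $B$ for which multiplication $A(G)\otimes B\to B$ extends to a complete contraction $A(G)\widehat\otimes_{op}B\to B$. Let $B$ be a Segal algebra (respectively, an operator Segal algebra) in $A(G)$, and write $B\,\widetilde\otimes\, B$ for the projective tensor product $B\widehat\otimes B$ (respectively, the operator space projective tensor product $B\widehat\otimes_{op}B$), with the module actions determined by $a\cdot(b\otimes c)=ab\otimes c$, $(b\otimes c)\cdot a=b\otimes ca$. Let $\pi$ be the product map $b\otimes c\mapsto bc$, extended to $B\,\widetilde\otimes\, B$ by taking the closure of its graph; so $\pi$ is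 the usual bounded map to $B$ whenever the product is bounded on $B\,\widetilde\otimes\,B$, which is always so for $B\widehat\otimes B$, and holds for $B\widehat\otimes_{op}B$ when the product of $B$ is jointly completely bounded. (A statement about $\pi(m)$ includes that $m$ is in the domain of $\pi$.) We say that * $B$ has an approximate identity if there is a (possibly unbounded) net $(e_\lambda)$ in $B$ with $e_\lambda a\to a$ and $ae_\lambda\to a$ in $B$ for every $a\in B$; * $B$ is (respectively, operator) approximately biprojective if there is a net of bounded (respectively, completely bounded) $B$-bimodule maps $T_\alpha:B\to B\,\widetilde\otimes\, B$ with $\pi(T_\alpha(a))\to a$ for every $a\in B$; * $B$ is (respectively, operator) pseudo-contractible if there is a (possibly unbounded) net $(m_\alpha)$ in $B\,\widetilde\otimes\, B$ with $a\cdot m_\alpha=m_\alpha\cdot a$ for all $\alpha$ and all $a\in B$, and $\pi(m_\alpha)a\to a$ for every $a\in B$. Then, for every Segal algebra $B$ in $A(G)$, the following are equivalent: (i) $B$ has an approximate identity and $G$ is discrete; (ii) $B$ has an approximate identity and is approximately biprojective; (iii) $B$ is pseudo-contractible. Likewise, for every operator Segal algebra $B$ in $A(G)$, the following are equivalent: (i)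 $B$ has an approximate identity and $G$ is discrete; (ii) $B$ has an approximate identity and is operator approximately biprojective; (iii) $B$ is operator pseudo-contractible. -/

import Mathlib

open MeasureTheory Filter Topology TensorProduct
open scoped InnerProductSpace

universe u

/-! ### Matrices over a vector space -/

/-- The norm of a rectangular complex matrix as an operator between finite-dimensional
Euclidean (Hilbert) spaces. -/
noncomputable def scalarNorm {m n : Type} [Fintype m] [Fintype n] [DecidableEq n]
    (A : Matrix m n ℂ) : ℝ :=
  ‖LinearMap.toContinuousLinearMap (Matrix.toEuclideanLin A)‖

/-- The product `α X β` of a scalar matrix, a square matrix of vectors, and a scalar matrix. -/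
def compress {V : Type*} [AddCommGroup V] [Module ℂ V] {m k : Type} [Fintype k]
    (α : Matrix m k ℂ) (X : Matrix k k V) (β : Matrix k m ℂ) : Matrix m m V :=
  Matrix.of fun i j => ∑ a, ∑ b, (α i a * β b j) • X a b

/-- The block diagonal matrix `v ⊕ w`. -/
def blockSum {V : Type*} [AddCommGroup V] {p q : ℕ}
    (v : Matrix (Fin p) (Fin p) V) (w : Matrix (Fin q) (Fin q) V) :
    Matrix (Fin (p + q)) (Fin (p + q)) V :=
  (Matrix.fromBlocks v 0 0 w).submatrix finSumFinEquiv.symm finSumFinEquiv.symm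

/-- The matrix `v ⊗ w = [v i j ⊗ w k l]`, indexed by pairs. -/
def tensorMatrix {V W : Type*} [AddCommGroup V] [Module ℂ V] [AddCommGroup W] [Module ℂ W]
    {p q : ℕ} (v : Matrix (Fin p) (Fin p) V) (w : Matrix (Fin q) (Fin q) W) :
    Matrix (Fin p × Fin q) (Fin p × Fin q) (V ⊗[ℂ] W) :=
  Matrix.of fun x y => v x.1 y.1 ⊗ₜ[ℂ] w x.2 y.2

/-! ### Operator spaces -/

/-- A family of real-valued functions on the spaces of square matrices over `V`. -/
abbrev MatrixNorms (V : Type*) := (n : ℕ) → Matrix (Fin n) (Fin n) V → ℝ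

/-- An operator space structure on a complex vector space: a norm on each matrix space,
subject to Ruan's two axioms. (Completeness is imposed separately.) -/
structure OperatorSpaceStructure (V : Type*) [AddCommGroup V] [Module ℂ V] where
  mnorm : MatrixNorms V
  nonneg : ∀ n (v : Matrix (Fin n) (Fin n) V), 0 ≤ mnorm n v
  eq_zero : ∀ n (v : Matrix (Fin n) (Fin n) V), mnorm n v = 0 → v = 0
  smul : ∀ n (c : ℂ) (v : Matrix (Fin n) (Fin n) V), mnorm n (c • v) = ‖c‖ * mnorm n v
  add_le : ∀ n (v w : Matrix (Fin n) (Fin n) V), mnorm n (v + w) ≤ mnorm n v + mnorm n w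
  ruan_sum : ∀ p q (v : Matrix (Fin p) (Fin p) V) (w : Matrix (Fin q) (Fin q) V),
    mnorm (p + q) (blockSum v w) = max (mnorm p v) (mnorm q w)
  ruan_compress : ∀ p n (α : Matrix (Fin n) (Fin p) ℂ) (v : Matrix (Fin p) (Fin p) V)
    (β : Matrix (Fin p) (Fin n) ℂ),
    mnorm n (compress α v β) ≤ scalarNorm α * mnorm p v * scalarNorm β

section OpProj

variable {V W : Type*} [AddCommGroup V] [Module ℂ V] [AddCommGroup W] [Module ℂ W]

/-- The numbers `‖α‖ ‖v‖ ‖w‖ ‖β‖` over all representations `u = α (v ⊗ w) β`. -/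
def opProjCosts (N : MatrixNorms V) (M : MatrixNorms W) (n : ℕ)
    (u : Matrix (Fin n) (Fin n) (V ⊗[ℂ] W)) : Set ℝ :=
  {r | ∃ (p q : ℕ) (v : Matrix (Fin p) (Fin p) V) (w : Matrix (Fin q) (Fin q) W)
    (α : Matrix (Fin n) (Fin p × Fin q) ℂ) (β : Matrix (Fin p × Fin q) (Fin n) ℂ),
    u = compress α (tensorMatrix v w) β ∧ r = scalarNorm α * N p v * M q w * scalarNorm β}

/-- The operator space projective tensor norm on `n × n` matrices over the algebraic tensor
product. -/
noncomputable def opProjNorm (N : MatrixNorms V) (M : MatrixNorms W) (n : ℕ)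
    (u : Matrix (Fin n) (Fin n) (V ⊗[ℂ] W)) : ℝ :=
  sInf (opProjCosts N M n u)

end OpProj

section ScalarNorm

set_option linter.unusedSectionVars false

variable {m n : Type} [Fintype m] [Fintype n] [DecidableEq m] [DecidableEq n]

open scoped Matrix.Norms.L2Operator in
theorem scalarNorm_eq (A : Matrix m n ℂ) : scalarNorm A = ‖A‖ := rfl

theorem scalarNorm_nonneg (A : Matrix m n ℂ) : 0 ≤ scalarNorm A := norm_nonneg _

open scoped Matrix.Norms.L2Operator in
theorem scalarNorm_smul (c : ℂ) (A : Matrix m n ℂ) :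
    scalarNorm (c • A) = ‖c‖ * scalarNorm A := by
  simp only [scalarNorm_eq, norm_smul]

open scoped Matrix.Norms.L2Operator in
theorem scalarNorm_row {k l : Type} [Fintype k] [Fintype l] [DecidableEq k] [DecidableEq l]
    (A : Matrix m k ℂ) (B : Matrix m l ℂ) (C : Matrix m n ℂ)
    (h : C * C.conjTranspose = A * A.conjTranspose + B * B.conjTranspose) :
    scalarNorm C ^ 2 ≤ scalarNorm A ^ 2 + scalarNorm B ^ 2 := by
  simp only [scalarNorm_eq]
  have key : ∀ {j : Type} [Fintype j] [DecidableEq j] (X : Matrix m j ℂ),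
      ‖X * X.conjTranspose‖ = ‖X‖ ^ 2 := by
    intro j _ _ X
    have := Matrix.l2_opNorm_conjTranspose_mul_self X.conjTranspose
    rw [Matrix.conjTranspose_conjTranspose, Matrix.l2_opNorm_conjTranspose] at this
    rw [this, sq]
  rw [← key, ← key, ← key, h]
  exact norm_add_le _ _

open scoped Matrix.Norms.L2Operator in
theorem scalarNorm_conjTranspose (A : Matrix m n ℂ) :
    scalarNorm A.conjTranspose = scalarNorm A := by
  simp only [scalarNorm_eq, Matrix.l2_opNorm_conjTranspose]

open scoped Matrix.Norms.L2Operator in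
theorem scalarNorm_one_le : scalarNorm (1 : Matrix m m ℂ) ≤ 1 := by
  rw [scalarNorm_eq]
  have h := Matrix.l2_opNorm_conjTranspose_mul_self (1 : Matrix m m ℂ)
  simp only [Matrix.conjTranspose_one, mul_one] at h
  by_contra hlt
  push Not at hlt
  nlinarith

end ScalarNorm

section OpProjSeminorm

variable {V W : Type*} [AddCommGroup V] [Module ℂ V] [AddCommGroup W] [Module ℂ W]

theorem compress_smul {n p q : ℕ} (a b c d : ℂ)
    (v : Matrix (Fin p) (Fin p) V) (w : Matrix (Fin q) (Fin q) W)
    (α : Matrix (Fin n) (Fin p × Fin q) ℂ) (β : Matrix (Fin p × Fin q) (Fin n) ℂ) :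
    compress (a • α) (tensorMatrix (b • v) (c • w)) (d • β)
      = (a * b * c * d) • compress α (tensorMatrix v w) β := by
  ext i j
  simp only [compress, tensorMatrix, Matrix.of_apply, Matrix.smul_apply, Finset.smul_sum,
    TensorProduct.smul_tmul', TensorProduct.tmul_smul, smul_smul, smul_eq_mul]
  refine Finset.sum_congr rfl fun x _ => Finset.sum_congr rfl fun y _ => ?_
  congr 1
  ring_nf

/-- Two row-type coefficient matrices put side by side, on the diagonal blocks of
`(p + p') × (q + q')`. -/
def rowJoin {n p q p' q' : ℕ} (α : Matrix (Fin n) (Fin p × Fin q) ℂ)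
    (α' : Matrix (Fin n) (Fin p' × Fin q') ℂ) :
    Matrix (Fin n) (Fin (p + p') × Fin (q + q')) ℂ :=
  Matrix.of fun i x =>
    Fin.addCases (fun a => Fin.addCases (fun b => α i (a, b)) (fun _ => 0) x.2)
      (fun a => Fin.addCases (fun _ => 0) (fun b => α' i (a, b)) x.2) x.1

set_option linter.unusedSectionVars false

theorem blockSum_ll {p q : ℕ} (v : Matrix (Fin p) (Fin p) V) (w : Matrix (Fin q) (Fin q) V)
    (i j : Fin p) : blockSum v w (Fin.castAdd q i) (Fin.castAdd q j) = v i j := by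
  simp [blockSum]

theorem blockSum_rr {p q : ℕ} (v : Matrix (Fin p) (Fin p) V) (w : Matrix (Fin q) (Fin q) V)
    (i j : Fin q) : blockSum v w (Fin.natAdd p i) (Fin.natAdd p j) = w i j := by
  simp [blockSum]

theorem blockSum_lr {p q : ℕ} (v : Matrix (Fin p) (Fin p) V) (w : Matrix (Fin q) (Fin q) V)
    (i : Fin p) (j : Fin q) : blockSum v w (Fin.castAdd q i) (Fin.natAdd p j) = 0 := by
  simp [blockSum]

theorem blockSum_rl {p q : ℕ} (v : Matrix (Fin p) (Fin p) V) (w : Matrix (Fin q) (Fin q) V)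
    (i : Fin q) (j : Fin p) : blockSum v w (Fin.natAdd p i) (Fin.castAdd q j) = 0 := by
  simp [blockSum]

theorem compress_join {n p q p' q' : ℕ}
    (v : Matrix (Fin p) (Fin p) V) (w : Matrix (Fin q) (Fin q) W)
    (v' : Matrix (Fin p') (Fin p') V) (w' : Matrix (Fin q') (Fin q') W)
    (α : Matrix (Fin n) (Fin p × Fin q) ℂ) (β : Matrix (Fin p × Fin q) (Fin n) ℂ)
    (α' : Matrix (Fin n) (Fin p' × Fin q') ℂ) (β' : Matrix (Fin p' × Fin q') (Fin n) ℂ) :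
    compress (rowJoin α α') (tensorMatrix (blockSum v v') (blockSum w w'))
        (rowJoin β.transpose β'.transpose).transpose
      = compress α (tensorMatrix v w) β + compress α' (tensorMatrix v' w') β' := by
  ext i j
  simp [compress, tensorMatrix, rowJoin, Fintype.sum_prod_type, Fin.sum_univ_add,
    blockSum_ll, blockSum_rr, blockSum_lr, blockSum_rl]

theorem scalarNorm_rowJoin {n p q p' q' : ℕ} (α : Matrix (Fin n) (Fin p × Fin q) ℂ)
    (α' : Matrix (Fin n) (Fin p' × Fin q') ℂ) :
    scalarNorm (rowJoin α α') ^ 2 ≤ scalarNorm α ^ 2 + scalarNorm α' ^ 2 := by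
  refine scalarNorm_row _ _ _ ?_
  ext i j
  simp [rowJoin, Matrix.mul_apply, Fintype.sum_prod_type, Fin.sum_univ_add]

theorem scalarNorm_transpose {m n : Type} [Fintype m] [Fintype n] [DecidableEq m]
    [DecidableEq n] (A : Matrix m n ℂ) : scalarNorm A.transpose = scalarNorm A := by
  have hle : ∀ {m n : Type} [Fintype m] [Fintype n] [DecidableEq m] [DecidableEq n]
      (A : Matrix m n ℂ), scalarNorm A.transpose ≤ scalarNorm A := by
    intro m n _ _ _ _ A
    rw [← scalarNorm_conjTranspose A.transpose]
    refine ContinuousLinearMap.opNorm_le_bound _ (norm_nonneg _) fun x => ?_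
    have h := (LinearMap.toContinuousLinearMap (Matrix.toEuclideanLin A)).le_opNorm
      (WithLp.toLp 2 fun i => star (x i))
    have e1 : ‖(WithLp.toLp 2 fun i => star (x i) : EuclideanSpace ℂ n)‖ = ‖x‖ := by
      simp [EuclideanSpace.norm_eq]
    have e2 : ‖(LinearMap.toContinuousLinearMap
        (Matrix.toEuclideanLin A.transpose.conjTranspose)) x‖
        = ‖(LinearMap.toContinuousLinearMap (Matrix.toEuclideanLin A))
          (WithLp.toLp 2 fun i => star (x i))‖ := by
      simp only [EuclideanSpace.norm_eq]
      congr 1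
      refine Finset.sum_congr rfl fun i _ => ?_
      congr 1
      rw [← norm_star]
      congr 1
      simp [Matrix.toLpLin_apply, Matrix.mulVec, dotProduct]
    rw [e2, ← e1]
    exact h
  exact le_antisymm (hle A) (by simpa using hle A.transpose)

variable (N : OperatorSpaceStructure V) (M : OperatorSpaceStructure W)

theorem opProjCosts_nonneg {n : ℕ} {u : Matrix (Fin n) (Fin n) (V ⊗[ℂ] W)} {r : ℝ}
    (hr : r ∈ opProjCosts N.mnorm M.mnorm n u) : 0 ≤ r := by
  obtain ⟨p, q, v, w, α, β, -, rfl⟩ := hr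
  have := N.nonneg p v
  have := M.nonneg q w
  have := scalarNorm_nonneg α
  have := scalarNorm_nonneg β
  positivity

theorem opProjNorm_nonneg {n : ℕ} (u : Matrix (Fin n) (Fin n) (V ⊗[ℂ] W)) :
    0 ≤ opProjNorm N.mnorm M.mnorm n u :=
  Real.sInf_nonneg fun _ hr => opProjCosts_nonneg N M hr

theorem opProjNorm_le {n : ℕ} {u : Matrix (Fin n) (Fin n) (V ⊗[ℂ] W)} {r : ℝ}
    (hr : r ∈ opProjCosts N.mnorm M.mnorm n u) : opProjNorm N.mnorm M.mnorm n u ≤ r :=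
  csInf_le ⟨0, fun _ h => opProjCosts_nonneg N M h⟩ hr

theorem opProjCosts_normalize {n : ℕ} {u : Matrix (Fin n) (Fin n) (V ⊗[ℂ] W)} {x r : ℝ}
    (hx : x ∈ opProjCosts N.mnorm M.mnorm n u) (hxr : x < r) :
    ∃ (p q : ℕ) (v : Matrix (Fin p) (Fin p) V) (w : Matrix (Fin q) (Fin q) W)
      (α : Matrix (Fin n) (Fin p × Fin q) ℂ) (β : Matrix (Fin p × Fin q) (Fin n) ℂ),
      u = compress α (tensorMatrix v w) β ∧ N.mnorm p v ≤ 1 ∧ M.mnorm q w ≤ 1 ∧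
      scalarNorm α ^ 2 ≤ r ∧ scalarNorm β ^ 2 ≤ r := by
  have hr : 0 < r := (opProjCosts_nonneg N M hx).trans_lt hxr
  obtain ⟨p, q, v, w, α, β, rfl, rfl⟩ := hx
  have hA := scalarNorm_nonneg α
  have hB := N.nonneg p v
  have hC := M.nonneg q w
  have hD := scalarNorm_nonneg β
  set A := scalarNorm α
  set B := N.mnorm p v
  set C := M.mnorm q w
  set D := scalarNorm β
  obtain ⟨δ, hδr, hδ⟩ : ∃ δ : ℝ, (A + δ) * (B + δ) * (C + δ) * (D + δ) < r ∧ 0 < δ := by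
    have hc : Continuous fun δ : ℝ => (A + δ) * (B + δ) * (C + δ) * (D + δ) := by fun_prop
    have ht : ∀ᶠ δ in 𝓝 (0 : ℝ), (A + δ) * (B + δ) * (C + δ) * (D + δ) < r :=
      hc.continuousAt.eventually_lt_const (by simpa using hxr)
    exact ((ht.filter_mono nhdsWithin_le_nhds).and self_mem_nhdsWithin :
      ∀ᶠ δ in 𝓝[>] (0 : ℝ), _).exists
  have hA' : 0 < A + δ := by linarith
  have hB' : 0 < B + δ := by linarith
  have hC' : 0 < C + δ := by linarith
  have hD' : 0 < D + δ := by linarith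
  have hs : 0 < Real.sqrt r := Real.sqrt_pos.2 hr
  have hss : Real.sqrt r * Real.sqrt r = r := Real.mul_self_sqrt hr.le
  have hA1 : A / (A + δ) ≤ 1 := (div_le_one hA').2 (by linarith)
  have hD1 : D / (D + δ) ≤ 1 := (div_le_one hD').2 (by linarith)
  have hA0 : 0 ≤ A / (A + δ) := by positivity
  have hD0 : 0 ≤ D / (D + δ) := by positivity
  set c : ℝ := (A + δ) * (B + δ) * (C + δ) * (D + δ) / r with hc
  have hc0 : 0 ≤ c := by positivity
  have hc1 : c ≤ 1 := (div_le_one hr).2 hδr.le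
  refine ⟨p, q, (((B + δ)⁻¹ : ℝ) : ℂ) • v, (((C + δ)⁻¹ : ℝ) : ℂ) • w,
    ((c * (Real.sqrt r / (A + δ)) : ℝ) : ℂ) • α, ((Real.sqrt r / (D + δ) : ℝ) : ℂ) • β,
    ?_, ?_, ?_, ?_, ?_⟩
  · rw [compress_smul]
    have : c * (Real.sqrt r / (A + δ)) * (B + δ)⁻¹ * (C + δ)⁻¹ * (Real.sqrt r / (D + δ)) = 1 := by
      calc _ = c * (Real.sqrt r * Real.sqrt r) / ((A + δ) * (B + δ) * (C + δ) * (D + δ)) := by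
            field_simp
        _ = 1 := by rw [hss, hc]; field_simp
    have h2 := congrArg (fun x : ℝ => (x : ℂ)) this
    simp only [Complex.ofReal_mul, Complex.ofReal_one] at h2
    simp only [Complex.ofReal_mul]
    rw [h2, one_smul]
  · rw [N.smul, Complex.norm_real, Real.norm_of_nonneg (by positivity), inv_mul_le_one₀ hB']
    change B ≤ _
    linarith
  · rw [M.smul, Complex.norm_real, Real.norm_of_nonneg (by positivity), inv_mul_le_one₀ hC']
    change C ≤ _
    linarith
  · rw [scalarNorm_smul, Complex.norm_real, Real.norm_of_nonneg (by positivity)]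
    change (c * (Real.sqrt r / (A + δ)) * A) ^ 2 ≤ r
    have : (c * (Real.sqrt r / (A + δ)) * A) ^ 2 = (c * (A / (A + δ))) ^ 2 * r := by
      calc _ = (c * (A / (A + δ))) ^ 2 * (Real.sqrt r * Real.sqrt r) := by ring
        _ = _ := by rw [hss]
    rw [this]
    have h1 : c * (A / (A + δ)) ≤ 1 := mul_le_one₀ hc1 hA0 hA1
    have h0 : 0 ≤ c * (A / (A + δ)) := by positivity
    have : (c * (A / (A + δ))) ^ 2 ≤ 1 := pow_le_one₀ h0 h1
    nlinarith
  · rw [scalarNorm_smul, Complex.norm_real, Real.norm_of_nonneg (by positivity)]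
    change (Real.sqrt r / (D + δ) * D) ^ 2 ≤ r
    have : (Real.sqrt r / (D + δ) * D) ^ 2 = (D / (D + δ)) ^ 2 * r := by
      calc _ = (D / (D + δ)) ^ 2 * (Real.sqrt r * Real.sqrt r) := by ring
        _ = _ := by rw [hss]
    rw [this]
    have : (D / (D + δ)) ^ 2 ≤ 1 := pow_le_one₀ hD0 hD1
    nlinarith

theorem cost_aux {a b s t r : ℝ} (ha : 0 ≤ a) (hb : 0 ≤ b) (ht : 0 ≤ t)
    (hs1 : s ≤ 1) (ht1 : t ≤ 1) (har : a ^ 2 ≤ r) (hbr : b ^ 2 ≤ r) : a * s * t * b ≤ r := by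
  have h1 : s * t ≤ 1 := mul_le_one₀ hs1 ht ht1
  have h2 : a * b * (s * t) ≤ a * b * 1 := mul_le_mul_of_nonneg_left h1 (mul_nonneg ha hb)
  nlinarith [sq_nonneg (a - b)]

theorem opProjCosts_add {n : ℕ} {u u' : Matrix (Fin n) (Fin n) (V ⊗[ℂ] W)} {x x' r r' : ℝ}
    (hx : x ∈ opProjCosts N.mnorm M.mnorm n u) (hxr : x < r)
    (hx' : x' ∈ opProjCosts N.mnorm M.mnorm n u') (hxr' : x' < r') :
    ∃ y ∈ opProjCosts N.mnorm M.mnorm n (u + u'), y ≤ r + r' := by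
  obtain ⟨p, q, v, w, α, β, rfl, hv, hw, hα, hβ⟩ := opProjCosts_normalize N M hx hxr
  obtain ⟨p', q', v', w', α', β', rfl, hv', hw', hα', hβ'⟩ :=
    opProjCosts_normalize N M hx' hxr'
  refine ⟨_, ⟨p + p', q + q', blockSum v v', blockSum w w', rowJoin α α',
    (rowJoin β.transpose β'.transpose).transpose, (compress_join ..).symm, rfl⟩, ?_⟩
  rw [N.ruan_sum, M.ruan_sum, scalarNorm_transpose]
  have h1 := scalarNorm_rowJoin α α'
  have h2 := scalarNorm_rowJoin β.transpose β'.transpose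
  rw [scalarNorm_transpose, scalarNorm_transpose] at h2
  have h3 := scalarNorm_nonneg (rowJoin α α')
  have h4 := scalarNorm_nonneg (rowJoin β.transpose β'.transpose)
  have hv1 : max (N.mnorm p v) (N.mnorm p' v') ≤ 1 := max_le hv hv'
  have hw1 : max (M.mnorm q w) (M.mnorm q' w') ≤ 1 := max_le hw hw'
  have hw0 : 0 ≤ max (M.mnorm q w) (M.mnorm q' w') := le_max_of_le_left (M.nonneg _ _)
  exact cost_aux h3 h4 hw0 hv1 hw1 (h1.trans (add_le_add hα hα'))
    (h2.trans (add_le_add hβ hβ'))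

theorem mem_opProjCosts_of_tmul (v : V) (w : W) :
    ∃ r, r ∈ opProjCosts N.mnorm M.mnorm 1 (Matrix.of fun _ _ => v ⊗ₜ[ℂ] w) := by
  refine ⟨_, 1, 1, Matrix.of fun _ _ => v, Matrix.of fun _ _ => w, Matrix.of fun _ _ => 1,
    Matrix.of fun _ _ => 1, ?_, rfl⟩
  ext i j
  simp [compress, tensorMatrix]

theorem opProjCosts_nonempty (u : V ⊗[ℂ] W) :
    (opProjCosts N.mnorm M.mnorm 1 (Matrix.of fun _ _ => u)).Nonempty := by
  induction u using TensorProduct.induction_on with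
  | zero =>
    have h := mem_opProjCosts_of_tmul N M (0 : V) (0 : W)
    rw [TensorProduct.zero_tmul] at h
    exact h
  | tmul v w => exact mem_opProjCosts_of_tmul N M v w
  | add x y hx hy =>
    obtain ⟨a, ha⟩ := hx
    obtain ⟨b, hb⟩ := hy
    obtain ⟨c, hc, -⟩ := opProjCosts_add N M ha (lt_add_one a) hb (lt_add_one b)
    exact ⟨c, hc⟩

/-- The operator space projective norm on `V ⊗ W`. -/
noncomputable def opProjSeminorm : Seminorm ℂ (V ⊗[ℂ] W) :=
  Seminorm.ofSMulLE (fun u => opProjNorm N.mnorm M.mnorm 1 (Matrix.of fun _ _ => u))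
    (by
      refine le_antisymm ?_ (opProjNorm_nonneg N M _)
      refine opProjNorm_le N M ⟨0, 0, 0, 0, 0, 0, ?_, ?_⟩
      · ext i j
        simp [compress]
      · have h : N.mnorm 0 0 = 0 := by simpa using N.smul 0 0 0
        simp [h])
    (by
      intro x y
      refine le_of_forall_pos_lt_add fun ε hε => ?_
      obtain ⟨a, ha, hax⟩ := exists_lt_of_csInf_lt (opProjCosts_nonempty N M x)
        (lt_add_of_pos_right (sInf _) (by positivity : 0 < ε / 3))
      obtain ⟨b, hb, hby⟩ := exists_lt_of_csInf_lt (opProjCosts_nonempty N M y)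
        (lt_add_of_pos_right (sInf _) (by positivity : 0 < ε / 3))
      obtain ⟨c, hc, hcr⟩ := opProjCosts_add N M ha hax hb hby
      have := opProjNorm_le N M (u := Matrix.of fun _ _ => x + y) hc
      simp only [opProjNorm] at this ⊢
      linarith)
    (by
      intro c x
      refine le_of_forall_pos_lt_add fun ε hε => ?_
      have hc : 0 < ‖c‖ + 1 := by positivity
      obtain ⟨a, ha, hax⟩ := exists_lt_of_csInf_lt (opProjCosts_nonempty N M x)
        (lt_add_of_pos_right (sInf _) (by positivity : 0 < ε / (‖c‖ + 1)))
      obtain ⟨p, q, v, w, α, β, hu, rfl⟩ := ha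
      have h := opProjNorm_le N M (n := 1) (u := Matrix.of fun _ _ => c • x)
        ⟨p, q, v, w, c • α, β, by
          have := compress_smul c 1 1 1 v w α β
          simp only [one_smul, mul_one] at this
          rw [this, ← hu]
          rfl, rfl⟩
      rw [scalarNorm_smul] at h
      have h2 : ‖c‖ * (ε / (‖c‖ + 1)) < ε := by
        rw [mul_div_assoc', div_lt_iff₀ hc]
        nlinarith
      have h3 := mul_le_mul_of_nonneg_left hax.le (norm_nonneg c)
      simp only [opProjNorm] at h ⊢
      nlinarith)

end OpProjSeminorm

/-! ### The projective tensor norm of Banach spaces -/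

section Proj

variable (V W : Type*) [NormedAddCommGroup V] [NormedSpace ℂ V]
  [NormedAddCommGroup W] [NormedSpace ℂ W]

/-- The numbers `∑ ‖v i‖ ‖w i‖` over all representations `t = ∑ v i ⊗ w i`. -/
def projCosts {V W : Type*} [NormedAddCommGroup V] [NormedSpace ℂ V]
    [NormedAddCommGroup W] [NormedSpace ℂ W] (t : V ⊗[ℂ] W) : Set ℝ :=
  {r | ∃ (n : ℕ) (v : Fin n → V) (w : Fin n → W),
    t = ∑ i, v i ⊗ₜ[ℂ] w i ∧ r = ∑ i, ‖v i‖ * ‖w i‖}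

variable {V W}

theorem projCosts_nonneg {t : V ⊗[ℂ] W} {r : ℝ} (hr : r ∈ projCosts t) : 0 ≤ r := by
  obtain ⟨n, v, w, -, rfl⟩ := hr
  positivity

theorem projCosts_add {t t' : V ⊗[ℂ] W} {r r' : ℝ} (hr : r ∈ projCosts t)
    (hr' : r' ∈ projCosts t') : r + r' ∈ projCosts (t + t') := by
  obtain ⟨n, v, w, rfl, rfl⟩ := hr
  obtain ⟨n', v', w', rfl, rfl⟩ := hr'
  refine ⟨n + n', Fin.append v v', Fin.append w w', ?_, ?_⟩ <;> simp [Fin.sum_univ_add]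

theorem projCosts_smul (c : ℂ) {t : V ⊗[ℂ] W} {r : ℝ} (hr : r ∈ projCosts t) :
    ‖c‖ * r ∈ projCosts (c • t) := by
  obtain ⟨n, v, w, rfl, rfl⟩ := hr
  refine ⟨n, c • v, w, ?_, ?_⟩
  · simp [Finset.smul_sum, TensorProduct.smul_tmul']
  · simp [Finset.mul_sum, norm_smul, mul_assoc]

theorem projCosts_nonempty (t : V ⊗[ℂ] W) : (projCosts t).Nonempty := by
  induction t using TensorProduct.induction_on with
  | zero => exact ⟨0, 0, 0, 0, by simp, by simp⟩
  | tmul v w => exact ⟨_, 1, fun _ => v, fun _ => w, by simp, rfl⟩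
  | add x y hx hy =>
    obtain ⟨a, ha⟩ := hx
    obtain ⟨b, hb⟩ := hy
    exact ⟨_, projCosts_add ha hb⟩

theorem sInf_projCosts_le {t : V ⊗[ℂ] W} {r : ℝ} (hr : r ∈ projCosts t) :
    sInf (projCosts t) ≤ r :=
  csInf_le ⟨0, fun _ h => projCosts_nonneg h⟩ hr

variable (V W) in
/-- The projective tensor norm on `V ⊗ W`. -/
noncomputable def projSeminorm : Seminorm ℂ (V ⊗[ℂ] W) :=
  Seminorm.ofSMulLE (fun t => sInf (projCosts t))
    (le_antisymm (sInf_projCosts_le ⟨0, 0, 0, by simp, by simp⟩)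
      (Real.sInf_nonneg fun _ h => projCosts_nonneg h))
    (by
      intro x y
      refine le_of_forall_pos_lt_add fun ε hε => ?_
      obtain ⟨a, ha, hax⟩ := exists_lt_of_csInf_lt (projCosts_nonempty x)
        (lt_add_of_pos_right (sInf _) (half_pos hε))
      obtain ⟨b, hb, hby⟩ := exists_lt_of_csInf_lt (projCosts_nonempty y)
        (lt_add_of_pos_right (sInf _) (half_pos hε))
      have := sInf_projCosts_le (projCosts_add ha hb)
      linarith)
    (by
      intro c x
      refine le_of_forall_pos_lt_add fun ε hε => ?_
      have hc : 0 < ‖c‖ + 1 := by positivity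
      obtain ⟨a, ha, hax⟩ := exists_lt_of_csInf_lt (projCosts_nonempty x)
        (lt_add_of_pos_right (sInf _) (by positivity : 0 < ε / (‖c‖ + 1)))
      have h := sInf_projCosts_le (projCosts_smul c ha)
      have h2 : ‖c‖ * (ε / (‖c‖ + 1)) < ε := by
        rw [mul_div_assoc', div_lt_iff₀ hc]
        nlinarith
      have h3 := mul_le_mul_of_nonneg_left hax.le (norm_nonneg c)
      nlinarith)

end Proj

/-! ### Completed tensor products -/

section Completed

variable {V W : Type*} [AddCommGroup V] [Module ℂ V] [AddCommGroup W] [Module ℂ W]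

/-- The algebraic tensor product, carrying a given seminorm. -/
def SeminormedTensor (_p : Seminorm ℂ (V ⊗[ℂ] W)) := V ⊗[ℂ] W

noncomputable instance (p : Seminorm ℂ (V ⊗[ℂ] W)) :
    SeminormedAddCommGroup (SeminormedTensor p) :=
  p.toAddGroupSeminorm.toSeminormedAddCommGroup

noncomputable instance (p : Seminorm ℂ (V ⊗[ℂ] W)) : Module ℂ (SeminormedTensor p) :=
  inferInstanceAs (Module ℂ (V ⊗[ℂ] W))

noncomputable instance (p : Seminorm ℂ (V ⊗[ℂ] W)) : NormedSpace ℂ (SeminormedTensor p) where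
  norm_smul_le c t := (map_smul_eq_mul p c t).le

/-- The completion of the algebraic tensor product for the seminorm `p`. -/
abbrev CompletedTensor (p : Seminorm ℂ (V ⊗[ℂ] W)) :=
  UniformSpace.Completion (SeminormedTensor p)

/-- The canonical map from the algebraic tensor product to its completion. -/
noncomputable def toCompleted (p : Seminorm ℂ (V ⊗[ℂ] W)) (t : V ⊗[ℂ] W) : CompletedTensor p :=
  ((show SeminormedTensor p from t : SeminormedTensor p) : CompletedTensor p)

/-- The extension by continuity of a bounded linear map `f` to the completion. -/
noncomputable def extendMap (p : Seminorm ℂ (V ⊗[ℂ] W)) (f : V ⊗[ℂ] W →ₗ[ℂ] V ⊗[ℂ] W) :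
    CompletedTensor p → CompletedTensor p :=
  UniformSpace.Completion.map (α := SeminormedTensor p) (β := SeminormedTensor p) f

theorem extendMap_continuous (p : Seminorm ℂ (V ⊗[ℂ] W)) (f : V ⊗[ℂ] W →ₗ[ℂ] V ⊗[ℂ] W) :
    Continuous (extendMap p f) :=
  UniformSpace.Completion.continuous_map

theorem extendMap_coe (p : Seminorm ℂ (V ⊗[ℂ] W)) (f : V ⊗[ℂ] W →ₗ[ℂ] V ⊗[ℂ] W)
    (C : ℝ) (hC : ∀ t, p (f t) ≤ C * p t) (t : V ⊗[ℂ] W) :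
    extendMap p f (toCompleted p t) = toCompleted p (f t) := by
  let g : SeminormedTensor p →ₗ[ℂ] SeminormedTensor p := f
  have hf : UniformContinuous g := (AddMonoidHomClass.lipschitz_of_bound g C hC).uniformContinuous
  exact UniformSpace.Completion.map_coe hf t

end Completed

/-! ### Approximate identities, pseudo-contractibility, approximate biprojectivity -/

section Algebra

variable {B : Type u} [NormedAddCommGroup B] [NormedSpace ℂ B]

/-- `B`, with product `mul`, has a (two-sided, possibly unbounded) approximate identity. -/
def HasApproximateIdentity (mul : B →ₗ[ℂ] B →ₗ[ℂ] B) : Prop :=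
  ∃ (Λ : Type u) (_ : Nonempty Λ) (_ : Preorder Λ) (_ : IsDirectedOrder Λ) (e : Λ → B),
    ∀ a, Tendsto (fun l => mul (e l) a) atTop (𝓝 a) ∧
      Tendsto (fun l => mul a (e l)) atTop (𝓝 a)

/-- The left action on the completed tensor product, `a · (b ⊗ c) = ab ⊗ c`. -/
noncomputable def leftAct (mul : B →ₗ[ℂ] B →ₗ[ℂ] B) (p : Seminorm ℂ (B ⊗[ℂ] B)) (a : B) :
    CompletedTensor p → CompletedTensor p :=
  extendMap p ((mul a).rTensor B)

/-- The right action on the completed tensor product, `(b ⊗ c) · a = b ⊗ ca`. -/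
noncomputable def rightAct (mul : B →ₗ[ℂ] B →ₗ[ℂ] B) (p : Seminorm ℂ (B ⊗[ℂ] B)) (a : B) :
    CompletedTensor p → CompletedTensor p :=
  extendMap p ((mul.flip a).lTensor B)

/-- `IsProduct mul p m b` says `π(m) = b`, where `π` is the product map `b ⊗ c ↦ bc` on the
completed tensor product, obtained as the closure of its graph on the algebraic tensor product.
When the product is bounded for `p`, this is the graph of the continuous extension
(`isProduct_iff`). -/
def IsProduct (mul : B →ₗ[ℂ] B →ₗ[ℂ] B) (p : Seminorm ℂ (B ⊗[ℂ] B))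
    (m : CompletedTensor p) (b : B) : Prop :=
  (m, b) ∈ closure (Set.range fun t : B ⊗[ℂ] B => (toCompleted p t, TensorProduct.lift mul t))

/-- Existence of a net `m` in the completed tensor product with `a · m = m · a` and
`π(m) a → a` for all `a`. -/
def PseudoContractible (mul : B →ₗ[ℂ] B →ₗ[ℂ] B) (p : Seminorm ℂ (B ⊗[ℂ] B)) : Prop :=
  ∃ (Λ : Type u) (_ : Nonempty Λ) (_ : Preorder Λ) (_ : IsDirectedOrder Λ)
    (m : Λ → CompletedTensor p) (c : Λ → B),
    (∀ l, IsProduct mul p (m l) (c l)) ∧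
    (∀ l a, leftAct mul p a (m l) = rightAct mul p a (m l)) ∧
    ∀ a, Tendsto (fun l => mul (c l) a) atTop (𝓝 a)

/-- Existence of a net of bounded bimodule maps `T` from `B` to the completed tensor product,
each satisfying `Admissible`, with `π(T a) → a` for all `a`. -/
def ApproximatelyBiprojective (mul : B →ₗ[ℂ] B →ₗ[ℂ] B) (p : Seminorm ℂ (B ⊗[ℂ] B))
    (Admissible : (B →L[ℂ] CompletedTensor p) → Prop) : Prop :=
  ∃ (Λ : Type u) (_ : Nonempty Λ) (_ : Preorder Λ) (_ : IsDirectedOrder Λ)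
    (T : Λ → B →L[ℂ] CompletedTensor p) (c : Λ → B → B),
    (∀ l, Admissible (T l)) ∧
    (∀ l a b, T l (mul a b) = leftAct mul p a (T l b) ∧
      T l (mul b a) = rightAct mul p a (T l b)) ∧
    (∀ l a, IsProduct mul p (T l a) (c l a)) ∧
    ∀ a, Tendsto (fun l => c l a) atTop (𝓝 a)

/-- If the product is bounded for `p`, it extends to a bounded linear map on the completed tensor
product, and `IsProduct` is the graph of that map. -/
theorem isProduct_iff [CompleteSpace B] (mul : B →ₗ[ℂ] B →ₗ[ℂ] B) (p : Seminorm ℂ (B ⊗[ℂ] B))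
    (C : ℝ) (hC : ∀ t, ‖TensorProduct.lift mul t‖ ≤ C * p t) :
    ∃ π : CompletedTensor p →L[ℂ] B,
      (∀ t, π (toCompleted p t) = TensorProduct.lift mul t) ∧
      ∀ m b, IsProduct mul p m b ↔ π m = b := by
  let f : SeminormedTensor p →L[ℂ] B :=
    LinearMap.mkContinuous (show SeminormedTensor p →ₗ[ℂ] B from TensorProduct.lift mul) C hC
  let π : CompletedTensor p →L[ℂ] B := f.extend UniformSpace.Completion.toComplL
  have hπ : ∀ t, π (toCompleted p t) = TensorProduct.lift mul t := fun t =>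
    f.extend_eq (UniformSpace.Completion.denseRange_coe)
      (UniformSpace.Completion.isUniformInducing_coe _) t
  refine ⟨π, hπ, fun m b => ⟨fun h => ?_, ?_⟩⟩
  · have hcl : IsClosed {x : CompletedTensor p × B | π x.1 = x.2} :=
      isClosed_eq (π.continuous.comp continuous_fst) continuous_snd
    refine (closure_minimal ?_ hcl) h
    rintro _ ⟨t, rfl⟩
    exact hπ t
  · rintro rfl
    have hc : Continuous fun m : CompletedTensor p => (m, π m) :=
      continuous_id.prodMk π.continuous
    have hd : m ∈ closure (Set.range (toCompleted p)) :=
      UniformSpace.Completion.denseRange_coe m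
    have := image_closure_subset_closure_image hc ⟨m, hd, rfl⟩
    refine closure_mono ?_ this
    rintro _ ⟨_, ⟨t, rfl⟩, rfl⟩
    exact ⟨t, by simp only [hπ]⟩

end Algebra

/-! ### Complete boundedness of maps into the operator space projective tensor product -/

section OpCompleted

variable {V W X : Type*} [AddCommGroup V] [Module ℂ V] [AddCommGroup W] [Module ℂ W]
  [AddCommGroup X] [Module ℂ X]

/-- The matrix norms of the completed operator space projective tensor product: the extension by
continuity of `opProjNorm`. A matrix has norm at most `r` when it is a limit of matrices over the
algebraic tensor product of norm at most `r`, or at most `r + ε` for every `ε > 0`. -/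
noncomputable def completedOpNorm (N : OperatorSpaceStructure V) (M : OperatorSpaceStructure W) :
    MatrixNorms (CompletedTensor (opProjSeminorm N M)) := fun n U =>
  sInf {r : ℝ | 0 ≤ r ∧ U ∈ closure
    ((fun u : Matrix (Fin n) (Fin n) (V ⊗[ℂ] W) => u.map (toCompleted (opProjSeminorm N M))) ''
      {u | opProjNorm N.mnorm M.mnorm n u ≤ r})}

/-- Complete boundedness of a linear map from an operator space to the completed operator space
projective tensor product. -/
def IsCompletelyBounded (L : OperatorSpaceStructure X) (N : OperatorSpaceStructure V)
    (M : OperatorSpaceStructure W) (T : X →ₗ[ℂ] CompletedTensor (opProjSeminorm N M)) : Prop :=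
  ∃ K : ℝ, ∀ n (x : Matrix (Fin n) (Fin n) X),
    completedOpNorm N M n (x.map T) ≤ K * L.mnorm n x

end OpCompleted

section TensorBounds

theorem projSeminorm_rTensor_le {V W : Type*} [NormedAddCommGroup V] [NormedSpace ℂ V]
    [NormedAddCommGroup W] [NormedSpace ℂ W] (f : V →ₗ[ℂ] V) (K : ℝ)
    (hf : ∀ v, ‖f v‖ ≤ K * ‖v‖) (hK : 0 ≤ K) (t : V ⊗[ℂ] W) :
    projSeminorm V W (f.rTensor W t) ≤ K * projSeminorm V W t := by
  refine le_of_forall_pos_lt_add fun ε hε => ?_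
  have hc : 0 < K + 1 := by positivity
  obtain ⟨a, ha, hax⟩ := exists_lt_of_csInf_lt (projCosts_nonempty t)
    (lt_add_of_pos_right (sInf _) (by positivity : 0 < ε / (K + 1)))
  obtain ⟨n, v, w, rfl, rfl⟩ := ha
  have h := sInf_projCosts_le (t := f.rTensor W (∑ i, v i ⊗ₜ[ℂ] w i))
    ⟨n, fun i => f (v i), w, by simp, rfl⟩
  have h1 : ∑ i, ‖f (v i)‖ * ‖w i‖ ≤ K * ∑ i, ‖v i‖ * ‖w i‖ := by
    rw [Finset.mul_sum]
    refine Finset.sum_le_sum fun i _ => ?_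
    rw [← mul_assoc]
    exact mul_le_mul_of_nonneg_right (hf _) (norm_nonneg _)
  have h2 : K * (ε / (K + 1)) < ε := by
    rw [mul_div_assoc', div_lt_iff₀ hc]
    nlinarith
  have h3 := mul_le_mul_of_nonneg_left hax.le hK
  change sInf (projCosts _) < K * sInf (projCosts _) + ε
  linarith

theorem projSeminorm_lTensor_le {V W : Type*} [NormedAddCommGroup V] [NormedSpace ℂ V]
    [NormedAddCommGroup W] [NormedSpace ℂ W] (f : W →ₗ[ℂ] W) (K : ℝ)
    (hf : ∀ w, ‖f w‖ ≤ K * ‖w‖) (hK : 0 ≤ K) (t : V ⊗[ℂ] W) :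
    projSeminorm V W (f.lTensor V t) ≤ K * projSeminorm V W t := by
  refine le_of_forall_pos_lt_add fun ε hε => ?_
  have hc : 0 < K + 1 := by positivity
  obtain ⟨a, ha, hax⟩ := exists_lt_of_csInf_lt (projCosts_nonempty t)
    (lt_add_of_pos_right (sInf _) (by positivity : 0 < ε / (K + 1)))
  obtain ⟨n, v, w, rfl, rfl⟩ := ha
  have h := sInf_projCosts_le (t := f.lTensor V (∑ i, v i ⊗ₜ[ℂ] w i))
    ⟨n, v, fun i => f (w i), by simp, rfl⟩
  have h1 : ∑ i, ‖v i‖ * ‖f (w i)‖ ≤ K * ∑ i, ‖v i‖ * ‖w i‖ := by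
    rw [Finset.mul_sum]
    refine Finset.sum_le_sum fun i _ => ?_
    rw [mul_left_comm]
    exact mul_le_mul_of_nonneg_left (hf _) (norm_nonneg _)
  have h2 : K * (ε / (K + 1)) < ε := by
    rw [mul_div_assoc', div_lt_iff₀ hc]
    nlinarith
  have h3 := mul_le_mul_of_nonneg_left hax.le hK
  change sInf (projCosts _) < K * sInf (projCosts _) + ε
  linarith

variable {V W : Type*} [AddCommGroup V] [Module ℂ V] [AddCommGroup W] [Module ℂ W]
  (N : OperatorSpaceStructure V) (M : OperatorSpaceStructure W)

theorem opProjSeminorm_map_le (f : V →ₗ[ℂ] V) (g : W →ₗ[ℂ] W) (K L : ℝ)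
    (hf : ∀ n v, N.mnorm n (v.map f) ≤ K * N.mnorm n v)
    (hg : ∀ n w, M.mnorm n (w.map g) ≤ L * M.mnorm n w) (hK : 0 ≤ K) (hL : 0 ≤ L)
    (t : V ⊗[ℂ] W) :
    opProjSeminorm N M (TensorProduct.map f g t) ≤ K * L * opProjSeminorm N M t := by
  refine le_of_forall_pos_lt_add fun ε hε => ?_
  have hKL : 0 ≤ K * L := mul_nonneg hK hL
  have hc : 0 < K * L + 1 := by positivity
  obtain ⟨a, ha, hax⟩ := exists_lt_of_csInf_lt (opProjCosts_nonempty N M t)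
    (lt_add_of_pos_right (sInf _) (by positivity : 0 < ε / (K * L + 1)))
  obtain ⟨p, q, v, w, α, β, hu, rfl⟩ := ha
  have h := opProjNorm_le N M (n := 1) (u := Matrix.of fun _ _ => TensorProduct.map f g t)
    ⟨p, q, v.map f, w.map g, α, β, by
      ext i j
      have := congrArg (TensorProduct.map f g) (congrFun (congrFun hu i) j)
      simp only [Matrix.of_apply] at this
      simp [this, compress, tensorMatrix], rfl⟩
  have h1 : N.mnorm p (v.map f) * M.mnorm q (w.map g)
      ≤ K * L * (N.mnorm p v * M.mnorm q w) := by
    calc _ ≤ (K * N.mnorm p v) * (L * M.mnorm q w) :=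
          mul_le_mul (hf _ _) (hg _ _) (M.nonneg _ _) (mul_nonneg hK (N.nonneg _ _))
      _ = _ := by ring
  have h2 : K * L * (ε / (K * L + 1)) < ε := by
    rw [mul_div_assoc', div_lt_iff₀ hc]
    nlinarith
  have h3 := mul_le_mul_of_nonneg_left hax.le hKL
  have h4 := mul_le_mul_of_nonneg_left h1
    (mul_nonneg (scalarNorm_nonneg α) (scalarNorm_nonneg β))
  change opProjNorm _ _ _ _ < K * L * opProjNorm _ _ _ _ + ε
  simp only [opProjNorm] at h ⊢
  nlinarith

end TensorBounds

/-! ### The Fourier algebra of a locally compact group -/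

section Fourier

/-- For a space `F` of bounded operators on a Hilbert space (included by `j`), the norm-closed
linear span of the vector functionals `T ↦ ⟨T ξ, η⟩` in the dual of `F`. -/
noncomputable def normalFunctionals {F H : Type*} [NormedAddCommGroup F] [NormedSpace ℂ F]
    [NormedAddCommGroup H] [InnerProductSpace ℂ H] (j : F → H →L[ℂ] H) :
    Submodule ℂ (F →L[ℂ] ℂ) :=
  (Submodule.span ℂ {φ | ∃ ξ η : H, ∀ T : F, φ T = ⟪η, j T ξ⟫_ℂ}).topologicalClosure

variable (G : Type u) [Group G] [TopologicalSpace G] [IsTopologicalGroup G]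
  [LocallyCompactSpace G] [MeasurableSpace G] [BorelSpace G]

/-- `L²(G)` with respect to left Haar measure. -/
noncomputable abbrev HaarL2 := Lp ℂ 2 (Measure.haar : Measure G)

variable {G} in
/-- The left regular representation, `(λ(s) ξ)(t) = ξ(s⁻¹ t)`. -/
noncomputable def leftRegular (s : G) : HaarL2 G →L[ℂ] HaarL2 G :=
  (Lp.compMeasurePreservingₗᵢ ℂ (fun t : G => s⁻¹ * t)
    (measurePreserving_mul_left Measure.haar s⁻¹)).toContinuousLinearMap

/-- The group von Neumann algebra `VN(G)`: the double commutant of the left regular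
representation. -/
noncomputable def groupVN : Subalgebra ℂ (HaarL2 G →L[ℂ] HaarL2 G) :=
  Subalgebra.centralizer ℂ (Set.centralizer (Set.range (leftRegular (G := G))))

variable {G} in
theorem leftRegular_mem (s : G) : leftRegular s ∈ groupVN G :=
  Set.subset_centralizer_centralizer ⟨s, rfl⟩

/-- `VN(G)` as a normed space, with the operator norm. -/
def VN : Type u := Subalgebra.toSubmodule (groupVN G)

noncomputable instance : NormedAddCommGroup (VN G) :=
  inferInstanceAs (NormedAddCommGroup (Subalgebra.toSubmodule (groupVN G)))

noncomputable instance : NormedSpace ℂ (VN G) :=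
  inferInstanceAs (NormedSpace ℂ (Subalgebra.toSubmodule (groupVN G)))

/-- The inclusion of `VN(G)` in the bounded operators on `L²(G)`. -/
def VN.op {G : Type u} [Group G] [TopologicalSpace G] [IsTopologicalGroup G]
    [LocallyCompactSpace G] [MeasurableSpace G] [BorelSpace G] (T : VN G) :
    HaarL2 G →L[ℂ] HaarL2 G :=
  T.1

/-- The predual of `VN(G)`, as a space of functionals: the norm-closed linear span of the vector
functionals `T ↦ ⟨T ξ, η⟩` in the dual of `VN(G)`. -/
noncomputable def groupVNPredual : Submodule ℂ (VN G →L[ℂ] ℂ) :=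
  normalFunctionals (VN.op (G := G))

/-- The function `s ↦ φ(λ(s))` on `G` associated with a functional `φ` on `VN(G)`. -/
noncomputable def functionOf : (VN G →L[ℂ] ℂ) →ₗ[ℂ] (G → ℂ) where
  toFun φ s := φ ⟨leftRegular s, leftRegular_mem s⟩
  map_add' _ _ := rfl
  map_smul' _ _ := rfl

/-- The Fourier algebra `A(G)`, as a space of functions on `G` (under pointwise operations):
the functions `s ↦ φ(λ(s))` with `φ` in the predual of `VN(G)`. -/
noncomputable def fourierAlgebra : Submodule ℂ (G → ℂ) :=
  (groupVNPredual G).map (functionOf G)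

variable {G} in
/-- The norm of `A(G)`: the norm of the functional in the predual of `VN(G)` that represents the
function. -/
noncomputable def fourierNorm (a : G → ℂ) : ℝ :=
  sInf {r | ∃ φ ∈ groupVNPredual G, functionOf G φ = a ∧ r = ‖φ‖}

variable {G} in
/-- The norm of a matrix over `VN(G)`, as an operator on the Hilbert space `L²(G)ᵐ`. -/
noncomputable def vnMatrixNorm {m : ℕ} (T : Matrix (Fin m) (Fin m) (VN G)) : ℝ :=
  sInf {c | 0 ≤ c ∧ ∀ ξ : Fin m → HaarL2 G,
    ∑ k, ‖∑ l, (T k l).op (ξ l)‖ ^ 2 ≤ c ^ 2 * ∑ l, ‖ξ l‖ ^ 2}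

/-- The operator space structure of `A(G)` as the predual of `VN(G)`: the norm of a matrix `[a i j]`
represented by the functionals `[φ i j]` is the completely bounded norm of the map
`T ↦ [φ i j (T)]` from `VN(G)` to the scalar matrices. -/
noncomputable def fourierMatrixNorm : MatrixNorms (fourierAlgebra G) := fun n a =>
  sInf {K | 0 ≤ K ∧ ∃ φ : Matrix (Fin n) (Fin n) (VN G →L[ℂ] ℂ),
    (∀ i j, φ i j ∈ groupVNPredual G ∧ functionOf G (φ i j) = a i j) ∧
    ∀ (m : ℕ) (T : Matrix (Fin m) (Fin m) (VN G)),
      scalarNorm (Matrix.of fun x y : Fin n × Fin m => φ x.1 y.1 (T x.2 y.2))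
        ≤ K * vnMatrixNorm T}

end Fourier

/-! ### Segal algebras in the Fourier algebra -/

section Segal

/-- Pointwise multiplication `A × B → B` when the space `B` of functions is an ideal over `A`. -/
noncomputable def pointwiseAction {G : Type u} (A B : Submodule ℂ (G → ℂ))
    (h : ∀ a ∈ A, ∀ b ∈ B, a * b ∈ B) : A →ₗ[ℂ] B →ₗ[ℂ] B :=
  LinearMap.mk₂ ℂ (fun a b => ⟨a * b, h a a.2 b b.2⟩)
    (fun _ _ _ => Subtype.ext (add_mul _ _ _))
    (fun _ _ _ => Subtype.ext (smul_mul_assoc _ _ _))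
    (fun _ _ _ => Subtype.ext (mul_add _ _ _))
    (fun _ _ _ => Subtype.ext (mul_smul_comm _ _ _))

variable (G : Type u) [Group G] [TopologicalSpace G] [IsTopologicalGroup G]
  [LocallyCompactSpace G] [MeasurableSpace G] [BorelSpace G]

/-- A Segal algebra in `A(G)`: a dense ideal with a complete norm for which it is a contractive
essential `A(G)`-module. -/
structure SegalAlgebra where
  carrier : Submodule ℂ (G → ℂ)
  le_fourier : carrier ≤ fourierAlgebra G
  dense : ∀ a ∈ fourierAlgebra G, ∀ ε > 0, ∃ b ∈ carrier, fourierNorm (a - b) < ε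
  mul_mem : ∀ a ∈ fourierAlgebra G, ∀ b ∈ carrier, a * b ∈ carrier
  nrm : carrier → ℝ
  nrm_nonneg : ∀ b, 0 ≤ nrm b
  nrm_smul : ∀ (c : ℂ) b, nrm (c • b) = ‖c‖ * nrm b
  nrm_add_le : ∀ b c, nrm (b + c) ≤ nrm b + nrm c
  nrm_eq_zero : ∀ b, nrm b = 0 ↔ b = 0
  complete : ∀ b : ℕ → carrier, (∀ ε > 0, ∃ k, ∀ m ≥ k, ∀ n ≥ k, nrm (b m - b n) < ε) →
    ∃ c, Tendsto (fun n => nrm (b n - c)) atTop (𝓝 0)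
  contractive : ∀ (a : fourierAlgebra G) (b : carrier),
    nrm (pointwiseAction (fourierAlgebra G) carrier mul_mem a b) ≤ fourierNorm (a : G → ℂ) * nrm b
  essential : ∀ b : carrier, ∀ ε > 0,
    ∃ c ∈ Submodule.span ℂ (Set.range fun x : fourierAlgebra G × carrier =>
      pointwiseAction (fourierAlgebra G) carrier mul_mem x.1 x.2), nrm (b - c) < ε

/-- An operator Segal algebra in `A(G)`: here the norm belongs to an operator space structure for
which the module action extends to a complete contraction on the operator space projective tensor
product with `A(G)`. -/
structure OperatorSegalAlgebra extends SegalAlgebra G where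
  opSpace : OperatorSpaceStructure carrier
  mnorm_one : ∀ b : carrier, opSpace.mnorm 1 (Matrix.of fun _ _ => b) = nrm b
  completelyContractive : ∀ n (u : Matrix (Fin n) (Fin n) (fourierAlgebra G ⊗[ℂ] carrier)),
    opSpace.mnorm n
        (u.map (TensorProduct.lift (pointwiseAction (fourierAlgebra G) carrier mul_mem)))
      ≤ opProjNorm (fourierMatrixNorm G) opSpace.mnorm n u

end Segal

namespace SegalAlgebra

variable {G : Type u} [Group G] [TopologicalSpace G] [IsTopologicalGroup G]
  [LocallyCompactSpace G] [MeasurableSpace G] [BorelSpace G] (S : SegalAlgebra G)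

/-- The underlying Banach space of a Segal algebra. -/
def Space : Type u := S.carrier

noncomputable instance : AddCommGroup S.Space := inferInstanceAs (AddCommGroup S.carrier)

noncomputable instance : Module ℂ S.Space := inferInstanceAs (Module ℂ S.carrier)

noncomputable instance : Norm S.Space := ⟨S.nrm⟩

theorem core : NormedSpace.Core ℂ S.Space where
  norm_nonneg := S.nrm_nonneg
  norm_smul := S.nrm_smul
  norm_triangle := S.nrm_add_le
  norm_eq_zero_iff := S.nrm_eq_zero

noncomputable instance : NormedAddCommGroup S.Space := NormedAddCommGroup.ofCore S.core

noncomputable instance : NormedSpace ℂ S.Space := NormedSpace.ofCore S.core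

instance : CompleteSpace S.Space := by
  refine Metric.complete_of_cauchySeq_tendsto fun b hb => ?_
  rw [Metric.cauchySeq_iff] at hb
  obtain ⟨c, hc⟩ := S.complete b fun ε hε => by
    obtain ⟨k, hk⟩ := hb ε hε
    refine ⟨k, fun m hm n hn => ?_⟩
    have := hk m hm n hn
    rwa [dist_eq_norm] at this
  exact ⟨c, tendsto_iff_norm_sub_tendsto_zero.2 hc⟩

/-- The pointwise product of a Segal algebra. -/
noncomputable def mul : S.Space →ₗ[ℂ] S.Space →ₗ[ℂ] S.Space :=
  pointwiseAction S.carrier S.carrier fun a ha b hb => S.mul_mem a (S.le_fourier ha) b hb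

theorem mul_comm (a b : S.Space) : S.mul a b = S.mul b a :=
  Subtype.ext (_root_.mul_comm (a.1 : G → ℂ) b.1)

theorem fourierNorm_nonneg (a : G → ℂ) : 0 ≤ fourierNorm a :=
  Real.sInf_nonneg fun _ ⟨φ, _, _, hr⟩ => hr ▸ norm_nonneg φ

theorem norm_mul_le (a b : S.Space) : ‖S.mul a b‖ ≤ fourierNorm (a.1 : G → ℂ) * ‖b‖ :=
  S.contractive ⟨a.1, S.le_fourier a.2⟩ b

/-- The projective tensor norm on `S ⊗ S`. -/
noncomputable abbrev proj : Seminorm ℂ (S.Space ⊗[ℂ] S.Space) := projSeminorm S.Space S.Space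

theorem leftAct_coe (a : S.Space) (t : S.Space ⊗[ℂ] S.Space) :
    leftAct S.mul S.proj a (toCompleted S.proj t)
      = toCompleted S.proj ((S.mul a).rTensor S.Space t) :=
  extendMap_coe _ _ _ (projSeminorm_rTensor_le _ _ (S.norm_mul_le a) (fourierNorm_nonneg _)) t

theorem rightAct_coe (a : S.Space) (t : S.Space ⊗[ℂ] S.Space) :
    rightAct S.mul S.proj a (toCompleted S.proj t)
      = toCompleted S.proj ((S.mul.flip a).lTensor S.Space t) :=
  extendMap_coe _ _ _ (projSeminorm_lTensor_le _ _
    (fun b => by rw [LinearMap.flip_apply, S.mul_comm]; exact S.norm_mul_le a b)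
    (fourierNorm_nonneg _)) t

/-- The product of a Segal algebra is bounded for the projective norm, so that it extends to a
bounded product map `π` on the projective tensor product. -/
theorem exists_productMap : ∃ π : CompletedTensor S.proj →L[ℂ] S.Space,
    (∀ t, π (toCompleted S.proj t) = TensorProduct.lift S.mul t) ∧
    ∀ m b, IsProduct S.mul S.proj m b ↔ π m = b := by
  let L : S.Space → S.Space →L[ℂ] S.Space := fun a =>
    (S.mul a).mkContinuous (fourierNorm (a.1 : G → ℂ)) (S.norm_mul_le a)
  obtain ⟨K, hK⟩ := banach_steinhaus (g := fun a : Metric.closedBall (0 : S.Space) 1 => L a)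
    fun b => ⟨fourierNorm (b.1 : G → ℂ), fun a => by
      change ‖S.mul a b‖ ≤ _
      rw [S.mul_comm]
      have h1 : ‖(a : S.Space)‖ ≤ 1 := mem_closedBall_zero_iff.1 a.2
      exact (S.norm_mul_le b a).trans (mul_le_of_le_one_right (fourierNorm_nonneg _) h1)⟩
  have hK0 : 0 ≤ K := (norm_nonneg _).trans (hK ⟨0, by simp⟩)
  have hmul : ∀ a b : S.Space, ‖S.mul a b‖ ≤ K * (‖a‖ * ‖b‖) := by
    intro a b
    by_cases ha : a = 0
    · simp [ha]
    have hn : 0 < ‖a‖ := norm_pos_iff.2 ha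
    have h := ((L ((‖a‖⁻¹ : ℝ) • a)).le_opNorm b).trans (mul_le_mul_of_nonneg_right
      (hK ⟨(‖a‖⁻¹ : ℝ) • a, by simp [norm_smul, hn.ne']⟩) (norm_nonneg b))
    have e : L ((‖a‖⁻¹ : ℝ) • a) b = ((‖a‖⁻¹ : ℝ) : ℂ) • S.mul a b := by
      change S.mul (((‖a‖⁻¹ : ℝ) : ℂ) • a) b = _
      rw [map_smul, LinearMap.smul_apply]
    rw [e, norm_smul, Complex.norm_real, Real.norm_of_nonneg (by positivity),
      inv_mul_le_iff₀ hn] at h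
    linarith
  refine isProduct_iff S.mul S.proj K fun t => ?_
  refine le_of_forall_pos_lt_add fun ε hε => ?_
  have hc : 0 < K + 1 := by positivity
  obtain ⟨r, hr, hrx⟩ := exists_lt_of_csInf_lt (projCosts_nonempty t)
    (lt_add_of_pos_right (sInf _) (by positivity : 0 < ε / (K + 1)))
  obtain ⟨n, v, w, rfl, rfl⟩ := hr
  have h1 : ‖TensorProduct.lift S.mul (∑ i, v i ⊗ₜ[ℂ] w i)‖ ≤ K * ∑ i, ‖v i‖ * ‖w i‖ := by
    rw [map_sum, Finset.mul_sum]
    exact (norm_sum_le _ _).trans (Finset.sum_le_sum fun i _ => by simpa using hmul (v i) (w i))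
  have h2 : K * (ε / (K + 1)) < ε := by
    rw [mul_div_assoc', div_lt_iff₀ hc]
    nlinarith
  have h3 := mul_le_mul_of_nonneg_left hrx.le hK0
  change _ < K * sInf (projCosts _) + ε
  linarith

/-- Pseudo-contractibility. -/
def IsPseudoContractible : Prop := PseudoContractible S.mul S.proj

/-- Approximate biprojectivity. -/
def IsApproximatelyBiprojective : Prop :=
  ApproximatelyBiprojective S.mul S.proj fun _ => True

end SegalAlgebra

namespace OperatorSegalAlgebra

variable {G : Type u} [Group G] [TopologicalSpace G] [IsTopologicalGroup G]
  [LocallyCompactSpace G] [MeasurableSpace G] [BorelSpace G] (S : OperatorSegalAlgebra G)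

/-- The operator space structure on the underlying Banach space. -/
def opStructure : OperatorSpaceStructure S.Space := S.opSpace

/-- The operator space projective tensor norm on `S ⊗ S`. -/
noncomputable abbrev opProj : Seminorm ℂ (S.Space ⊗[ℂ] S.Space) :=
  opProjSeminorm S.opStructure S.opStructure

theorem fourierMatrixNorm_nonneg (n : ℕ) (a : Matrix (Fin n) (Fin n) (fourierAlgebra G)) :
    0 ≤ fourierMatrixNorm G n a :=
  Real.sInf_nonneg fun _ h => h.1

/-- Multiplication by an element of the operator Segal algebra is completely bounded. -/
theorem mnorm_mul_le (a : S.Space) (n : ℕ) (b : Matrix (Fin n) (Fin n) S.Space) :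
    S.opStructure.mnorm n (b.map (S.mul a))
      ≤ fourierMatrixNorm G 1 (Matrix.of fun _ _ => ⟨a.1, S.le_fourier a.2⟩)
        * S.opStructure.mnorm n b := by
  let a' : fourierAlgebra G := ⟨a.1, S.le_fourier a.2⟩
  let α : Matrix (Fin n) (Fin 1 × Fin n) ℂ := Matrix.of fun i x => if i = x.2 then 1 else 0
  have hα : scalarNorm α ≤ 1 := by
    have h := scalarNorm_row (1 : Matrix (Fin n) (Fin n) ℂ) (0 : Matrix (Fin n) (Fin n) ℂ) α (by
      ext i j
      simp [α, Matrix.mul_apply, Fintype.sum_prod_type, Matrix.one_apply, eq_comm]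
      split_ifs <;> simp)
    have h1 := scalarNorm_one_le (m := Fin n)
    have h0 := scalarNorm_nonneg (1 : Matrix (Fin n) (Fin n) ℂ)
    have hz : scalarNorm (0 : Matrix (Fin n) (Fin n) ℂ) = 0 := by simp [scalarNorm]
    rw [hz] at h
    have := scalarNorm_nonneg α
    nlinarith
  let b' : Matrix (Fin n) (Fin n) S.carrier := b
  let u : Matrix (Fin n) (Fin n) (fourierAlgebra G ⊗[ℂ] S.carrier) :=
    Matrix.of fun i j => a' ⊗ₜ[ℂ] b' i j
  have hu : u = compress α (tensorMatrix (Matrix.of fun _ _ : Fin 1 => a') b') α.transpose := by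
    ext i j
    simp [u, α, compress, tensorMatrix, Fintype.sum_prod_type]
  have hcost : opProjNorm (fourierMatrixNorm G) S.opSpace.mnorm n u
      ≤ scalarNorm α * fourierMatrixNorm G 1 (Matrix.of fun _ _ => a') * S.opSpace.mnorm n b'
        * scalarNorm α.transpose := by
    refine csInf_le ⟨0, ?_⟩ ⟨1, n, _, b', α, α.transpose, hu, rfl⟩
    rintro _ ⟨p, q, v, w, γ, δ, -, rfl⟩
    have := fourierMatrixNorm_nonneg p v
    have := S.opSpace.nonneg q w
    have := scalarNorm_nonneg γ
    have := scalarNorm_nonneg δ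
    positivity
  rw [scalarNorm_transpose] at hcost
  have h0 := fourierMatrixNorm_nonneg 1 (Matrix.of fun _ _ : Fin 1 => a')
  have h1 := S.opSpace.nonneg n b'
  have h2 := scalarNorm_nonneg α
  have h3 : u.map (TensorProduct.lift
      (pointwiseAction (fourierAlgebra G) S.carrier S.mul_mem)) = b.map (S.mul a) := by
    ext i j
    rfl
  have h4 := S.completelyContractive n u
  rw [h3] at h4
  refine h4.trans (hcost.trans ?_)
  have h5 : scalarNorm α * scalarNorm α ≤ 1 := mul_le_one₀ hα h2 hα
  calc _ = scalarNorm α * scalarNorm α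
        * (fourierMatrixNorm G 1 (Matrix.of fun _ _ => a') * S.opSpace.mnorm n b') := by ring
    _ ≤ 1 * _ := mul_le_mul_of_nonneg_right h5 (mul_nonneg h0 h1)
    _ = _ := one_mul _

theorem leftAct_coe (a : S.Space) (t : S.Space ⊗[ℂ] S.Space) :
    leftAct S.mul S.opProj a (toCompleted S.opProj t)
      = toCompleted S.opProj ((S.mul a).rTensor S.Space t) :=
  extendMap_coe _ _ _ (opProjSeminorm_map_le _ _ _ _ _ 1 (S.mnorm_mul_le a)
    (fun n w => by simp) (fourierMatrixNorm_nonneg _ _) zero_le_one) t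

theorem rightAct_coe (a : S.Space) (t : S.Space ⊗[ℂ] S.Space) :
    rightAct S.mul S.opProj a (toCompleted S.opProj t)
      = toCompleted S.opProj ((S.mul.flip a).lTensor S.Space t) :=
  extendMap_coe _ _ _ (opProjSeminorm_map_le _ _ _ _ 1 _ (fun n w => by simp)
    (fun n w => by
      have : S.mul.flip a = S.mul a := LinearMap.ext fun b => S.mul_comm b a
      rw [this]
      exact S.mnorm_mul_le a n w) zero_le_one (fourierMatrixNorm_nonneg _ _)) t

/-- Operator pseudo-contractibility. -/
def IsOperatorPseudoContractible : Prop := PseudoContractible S.mul S.opProj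

/-- Operator approximate biprojectivity: the approximating bimodule maps are completely bounded. -/
def IsOperatorApproximatelyBiprojective : Prop :=
  ApproximatelyBiprojective S.mul S.opProj fun T =>
    IsCompletelyBounded S.opStructure S.opStructure S.opStructure T.toLinearMap

end OperatorSegalAlgebra

/-!
For a Segal algebra `S` in `A(G)`, approximate biprojectivity and pseudo-contractibility each give an
element `m` of the completed tensor product with `a · m = m · a` for all `a` and `π(m) = c ≠ 0`: a
value `T a` of a bimodule map in the first case, since the product is commutative, and a member of
the given net in the second.
Point evaluations are characters of a Banach algebra, hence uniformly bounded
(`SegalAlgebra.exists_norm_eval_le`), and their tensor products `δ_s ⊗ δ_t` are bounded for both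
tensor norms (`norm_tensorFunctional_le_projSeminorm`, `norm_tensorFunctional_le_opProjSeminorm`; the
second rests on bounded functionals being completely bounded). So `m` is a function on `G × G`,
continuous in each variable as a uniform limit of continuous functions. Commutation with `S`, which
separates points, forces it to vanish off the diagonal, and on the diagonal it equals `c`. If
`c s ≠ 0`, then `t ↦ m (s, t)` is a continuous function that is non-zero exactly at `s`, so `s` is
isolated and `G` is discrete (`SegalAlgebra.discreteTopology_of_leftAct_eq_rightAct`).

Conversely, if `G` is discrete, `S` contains the indicators `δ_s` of points, and the finitely
supported functions are dense in `S`: they are dense in `A(G)`, because coefficient functions of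
finitely supported vectors are finitely supported, and `A(G) · S` spans a dense subspace of `S`
(`SegalAlgebra.exists_finite_support_norm_sub_lt`). An approximate identity may therefore be taken
finitely supported. For such a function `f`, the element `m = ∑ f s • (δ_s ⊗ δ_s)` commutes with `S`
and has `π(m) = f`, so `S` is pseudo-contractible, and `a ↦ a · m` is a bimodule map of finite rank,
hence completely bounded (`isCompletelyBounded_of_finiteRank`), so `S` is approximately biprojective.
-/

/-! ### Norms of scalar matrices -/

section ScalarMatrices

variable {m n : Type} [Fintype m] [Fintype n] [DecidableEq n]

theorem sum_norm_sq_mulVec_le (A : Matrix m n ℂ) (x : n → ℂ) :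
    ∑ i, ‖A.mulVec x i‖ ^ 2 ≤ scalarNorm A ^ 2 * ∑ j, ‖x j‖ ^ 2 := by
  have h := (LinearMap.toContinuousLinearMap (Matrix.toEuclideanLin A)).le_opNorm
    (WithLp.toLp 2 x)
  have h2 := pow_le_pow_left₀ (norm_nonneg _) h 2
  rw [mul_pow, EuclideanSpace.norm_sq_eq, EuclideanSpace.norm_sq_eq] at h2
  simpa [scalarNorm] using h2

theorem scalarNorm_le_of_sum_norm_sq_le (A : Matrix m n ℂ) {C : ℝ} (hC : 0 ≤ C)
    (h : ∀ x : n → ℂ, ∑ i, ‖A.mulVec x i‖ ^ 2 ≤ C ^ 2 * ∑ j, ‖x j‖ ^ 2) :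
    scalarNorm A ≤ C := by
  refine ContinuousLinearMap.opNorm_le_bound _ hC fun x => ?_
  refine le_of_sq_le_sq ?_ (by positivity)
  rw [mul_pow, EuclideanSpace.norm_sq_eq, EuclideanSpace.norm_sq_eq]
  simpa using h (WithLp.ofLp x)

open scoped Matrix.Norms.L2Operator in
theorem scalarNorm_mul_le {k : Type} [Fintype k] [DecidableEq k] (A : Matrix m k ℂ)
    (B : Matrix k n ℂ) : scalarNorm (A * B) ≤ scalarNorm A * scalarNorm B := by
  exact Matrix.l2_opNorm_mul A B

theorem norm_apply_le_scalarNorm (A : Matrix (Fin 1) (Fin 1) ℂ) : ‖A 0 0‖ ≤ scalarNorm A := by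
  have h := sum_norm_sq_mulVec_le A 1
  simp [Matrix.mulVec, dotProduct] at h
  exact le_of_sq_le_sq h (scalarNorm_nonneg A)

theorem scalarNorm_column_le {n : Type} [Fintype n] (x : n → ℂ) :
    scalarNorm (Matrix.of fun j (_ : Fin 1) => x j) ≤ √(∑ j, ‖x j‖ ^ 2) := by
  refine scalarNorm_le_of_sum_norm_sq_le _ (Real.sqrt_nonneg _) fun y => ?_
  rw [Real.sq_sqrt (by positivity)]
  simp [Matrix.mulVec, dotProduct, mul_pow, Finset.sum_mul]

theorem scalarNorm_kronecker_one_le {k : Type} [Fintype k] [DecidableEq m] [DecidableEq k]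
    (A : Matrix m n ℂ) :
    scalarNorm (Matrix.kronecker A (1 : Matrix k k ℂ)) ≤ scalarNorm A := by
  refine scalarNorm_le_of_sum_norm_sq_le _ (scalarNorm_nonneg A) fun x => ?_
  rw [Fintype.sum_prod_type_right, Fintype.sum_prod_type_right, Finset.mul_sum]
  refine Finset.sum_le_sum fun b _ => ?_
  refine le_of_eq_of_le (Finset.sum_congr rfl fun a _ => ?_)
    (sum_norm_sq_mulVec_le A fun a => x (a, b))
  simp [Matrix.mulVec, dotProduct, Fintype.sum_prod_type, Matrix.one_apply]

theorem scalarNorm_one_kronecker_le {k : Type} [Fintype k] [DecidableEq m] [DecidableEq k]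
    (A : Matrix m n ℂ) :
    scalarNorm (Matrix.kronecker (1 : Matrix k k ℂ) A) ≤ scalarNorm A := by
  refine scalarNorm_le_of_sum_norm_sq_le _ (scalarNorm_nonneg A) fun x => ?_
  rw [Fintype.sum_prod_type, Fintype.sum_prod_type, Finset.mul_sum]
  refine Finset.sum_le_sum fun b _ => ?_
  refine le_of_eq_of_le (Finset.sum_congr rfl fun a _ => ?_)
    (sum_norm_sq_mulVec_le A fun a => x (b, a))
  simp [Matrix.mulVec, dotProduct, Fintype.sum_prod_type, Matrix.one_apply]

theorem scalarNorm_kronecker_le {p q : ℕ} (A : Matrix (Fin p) (Fin p) ℂ)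
    (B : Matrix (Fin q) (Fin q) ℂ) :
    scalarNorm (Matrix.kronecker A B) ≤ scalarNorm A * scalarNorm B := by
  have h : Matrix.kronecker A B = Matrix.kronecker A 1 * Matrix.kronecker 1 B := by
    have := Matrix.mul_kronecker_mul A (1 : Matrix (Fin p) (Fin p) ℂ)
      (1 : Matrix (Fin q) (Fin q) ℂ) B
    rwa [mul_one, one_mul] at this
  rw [h]
  exact (scalarNorm_mul_le _ _).trans (mul_le_mul (scalarNorm_kronecker_one_le A)
    (scalarNorm_one_kronecker_le B) (scalarNorm_nonneg _) (scalarNorm_nonneg _))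

end ScalarMatrices

/-! ### Functionals on operator spaces and their tensor products -/

section Functionals

variable {V W : Type*} [AddCommGroup V] [Module ℂ V] [AddCommGroup W] [Module ℂ W]

/-- The functional `φ ⊗ ψ` on `V ⊗ W`. -/
noncomputable def tensorFunctional (φ : V →ₗ[ℂ] ℂ) (ψ : W →ₗ[ℂ] ℂ) : V ⊗[ℂ] W →ₗ[ℂ] ℂ :=
  TensorProduct.lift ((LinearMap.mul ℂ ℂ).compl₁₂ φ ψ)

@[simp]
theorem tensorFunctional_tmul (φ : V →ₗ[ℂ] ℂ) (ψ : W →ₗ[ℂ] ℂ) (v : V) (w : W) :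
    tensorFunctional φ ψ (v ⊗ₜ[ℂ] w) = φ v * ψ w := by
  simp [tensorFunctional]

variable (N : OperatorSpaceStructure V) (M : OperatorSpaceStructure W)

/-- Bounded functionals on an operator space are completely bounded, with the same bound. -/
theorem scalarNorm_map_functional_le (φ : V →ₗ[ℂ] ℂ) {K : ℝ} (hK : 0 ≤ K)
    (hφ : ∀ v, ‖φ v‖ ≤ K * N.mnorm 1 (Matrix.of fun _ _ => v)) (n : ℕ)
    (v : Matrix (Fin n) (Fin n) V) : scalarNorm (v.map φ) ≤ K * N.mnorm n v := by
  refine scalarNorm_le_of_sum_norm_sq_le _ (mul_nonneg hK (N.nonneg _ _)) fun x => ?_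
  set y := (v.map φ).mulVec x with hy
  -- Testing against `y = φ(v) x` itself, `‖y‖² = φ(y* v x)`.
  let α : Matrix (Fin 1) (Fin n) ℂ := (Matrix.of fun j (_ : Fin 1) => star (y j)).transpose
  let β : Matrix (Fin n) (Fin 1) ℂ := Matrix.of fun j (_ : Fin 1) => x j
  have hα : scalarNorm α ≤ √(∑ j, ‖y j‖ ^ 2) := by
    rw [scalarNorm_transpose]
    simpa using scalarNorm_column_le fun j => star (y j)
  have hβ : scalarNorm β ≤ √(∑ j, ‖x j‖ ^ 2) := scalarNorm_column_le x
  have h1 := hφ (compress α v β 0 0)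
  have h2 : (Matrix.of fun _ _ => compress α v β 0 0) = compress α v β := by
    ext i j
    fin_cases i
    fin_cases j
    rfl
  rw [h2] at h1
  have h3 : φ (compress α v β 0 0) = ((∑ i, ‖y i‖ ^ 2 : ℝ) : ℂ) := by
    have : ∀ i, ((‖y i‖ ^ 2 : ℝ) : ℂ) = star (y i) * ∑ j, φ (v i j) * x j := by
      intro i
      have : y i = ∑ j, φ (v i j) * x j := rfl
      rw [← this, ← Complex.normSq_eq_norm_sq, Complex.normSq_eq_conj_mul_self]
      rfl
    simp only [Complex.ofReal_sum, this, compress, Matrix.of_apply, map_sum, map_smul, smul_eq_mul,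
      Finset.mul_sum, α, β, Matrix.transpose_apply]
    exact Finset.sum_congr rfl fun i _ => Finset.sum_congr rfl fun j _ => by ring
  have hY : 0 ≤ ∑ i, ‖y i‖ ^ 2 := by positivity
  have hX : 0 ≤ ∑ i, ‖x i‖ ^ 2 := by positivity
  rw [h3, Complex.norm_real, Real.norm_of_nonneg hY] at h1
  have h4 := N.ruan_compress n 1 α v β
  have hN := N.nonneg n v
  have h5 : scalarNorm α * N.mnorm n v * scalarNorm β
      ≤ √(∑ j, ‖y j‖ ^ 2) * N.mnorm n v * √(∑ j, ‖x j‖ ^ 2) := by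
    have := scalarNorm_nonneg β
    have := Real.sqrt_nonneg (∑ j, ‖y j‖ ^ 2)
    gcongr
  have h6 := h1.trans (mul_le_mul_of_nonneg_left (h4.trans h5) hK)
  have hs := Real.sq_sqrt hY
  have ht := Real.sq_sqrt hX
  set s := √(∑ j, ‖y j‖ ^ 2)
  set t := √(∑ j, ‖x j‖ ^ 2)
  have hs0 : 0 ≤ s := Real.sqrt_nonneg _
  have ht0 : 0 ≤ t := Real.sqrt_nonneg _
  rw [← hs, ← ht, ← mul_pow]
  rw [← hs] at h6
  rcases hs0.eq_or_lt with h0 | h0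
  · rw [← h0, zero_pow two_ne_zero]
    positivity
  · refine pow_le_pow_left₀ hs0 (le_of_mul_le_mul_left ?_ h0) 2
    linarith

/-- The tensor product of two bounded functionals is bounded for the operator space projective
norm. -/
theorem norm_tensorFunctional_le_opProjSeminorm (φ : V →ₗ[ℂ] ℂ) (ψ : W →ₗ[ℂ] ℂ) {K L : ℝ}
    (hK : 0 ≤ K) (hL : 0 ≤ L) (hφ : ∀ v, ‖φ v‖ ≤ K * N.mnorm 1 (Matrix.of fun _ _ => v))
    (hψ : ∀ w, ‖ψ w‖ ≤ L * M.mnorm 1 (Matrix.of fun _ _ => w)) (t : V ⊗[ℂ] W) :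
    ‖tensorFunctional φ ψ t‖ ≤ K * L * opProjSeminorm N M t := by
  have key : ∀ r ∈ opProjCosts N.mnorm M.mnorm 1 (Matrix.of fun _ _ => t),
      ‖tensorFunctional φ ψ t‖ ≤ K * L * r := by
    rintro _ ⟨p, q, v, w, α, β, hu, rfl⟩
    have hA := scalarNorm_map_functional_le N φ hK hφ p v
    have hB := scalarNorm_map_functional_le M ψ hL hψ q w
    have e : tensorFunctional φ ψ t
        = (α * Matrix.kronecker (v.map φ) (w.map ψ) * β) 0 0 := by
      have h0 : t = _ := congrFun (congrFun hu 0) 0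
      rw [h0]
      simp only [compress, tensorMatrix, Matrix.of_apply, map_sum, map_smul, smul_eq_mul,
        tensorFunctional_tmul, Matrix.mul_apply, Finset.sum_mul, Matrix.kronecker,
        Matrix.kroneckerMap_apply, Matrix.map_apply]
      rw [Finset.sum_comm]
      exact Finset.sum_congr rfl fun i _ => Finset.sum_congr rfl fun j _ => by ring
    rw [e]
    have h1 := norm_apply_le_scalarNorm (α * Matrix.kronecker (v.map φ) (w.map ψ) * β)
    have h2 := scalarNorm_mul_le (α * Matrix.kronecker (v.map φ) (w.map ψ)) β
    have h3 := scalarNorm_mul_le α (Matrix.kronecker (v.map φ) (w.map ψ))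
    have h4 := scalarNorm_kronecker_le (v.map φ) (w.map ψ)
    have nα := scalarNorm_nonneg α
    have nβ := scalarNorm_nonneg β
    have nB := scalarNorm_nonneg (w.map ψ)
    have nN := N.nonneg p v
    calc _ ≤ scalarNorm α * (scalarNorm (v.map φ) * scalarNorm (w.map ψ)) * scalarNorm β :=
          h1.trans (h2.trans (mul_le_mul_of_nonneg_right
            (h3.trans (mul_le_mul_of_nonneg_left h4 nα)) nβ))
      _ ≤ scalarNorm α * ((K * N.mnorm p v) * (L * M.mnorm q w)) * scalarNorm β := by
          gcongr
      _ = _ := by ring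
  rcases (mul_nonneg hK hL).eq_or_lt with h0 | h0
  · obtain ⟨r, hr⟩ := opProjCosts_nonempty N M t
    simpa [← h0] using key r hr
  · rw [← div_le_iff₀' h0]
    exact le_csInf (opProjCosts_nonempty N M t) fun r hr => (div_le_iff₀' h0).2 (key r hr)

/-- The tensor product of two bounded functionals is bounded for the projective norm. -/
theorem norm_tensorFunctional_le_projSeminorm {V W : Type*} [NormedAddCommGroup V]
    [NormedSpace ℂ V] [NormedAddCommGroup W] [NormedSpace ℂ W] (φ : V →ₗ[ℂ] ℂ) (ψ : W →ₗ[ℂ] ℂ)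
    {K L : ℝ} (hK : 0 ≤ K) (hL : 0 ≤ L) (hφ : ∀ v, ‖φ v‖ ≤ K * ‖v‖)
    (hψ : ∀ w, ‖ψ w‖ ≤ L * ‖w‖) (t : V ⊗[ℂ] W) :
    ‖tensorFunctional φ ψ t‖ ≤ K * L * projSeminorm V W t := by
  have key : ∀ r ∈ projCosts t, ‖tensorFunctional φ ψ t‖ ≤ K * L * r := by
    rintro _ ⟨n, v, w, rfl, rfl⟩
    rw [map_sum, Finset.mul_sum]
    refine (norm_sum_le _ _).trans (Finset.sum_le_sum fun i _ => ?_)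
    rw [tensorFunctional_tmul, norm_mul]
    calc _ ≤ (K * ‖v i‖) * (L * ‖w i‖) := by
          have := hφ (v i)
          have := hψ (w i)
          gcongr
      _ = _ := by ring
  rcases (mul_nonneg hK hL).eq_or_lt with h0 | h0
  · obtain ⟨r, hr⟩ := projCosts_nonempty t
    simpa [← h0] using key r hr
  · rw [← div_le_iff₀' h0]
    exact le_csInf (projCosts_nonempty t) fun r hr => (div_le_iff₀' h0).2 (key r hr)

/-- The matrix `v ⊗ 1ₙ` is an iterated block sum of copies of `v`. -/
theorem mnorm_diagonal_le (v : V) (n : ℕ) :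
    N.mnorm n (Matrix.diagonal fun _ => v) ≤ N.mnorm 1 (Matrix.of fun _ _ => v) := by
  induction n with
  | zero =>
    have h : (Matrix.diagonal fun _ : Fin 0 => v) = (0 : ℂ) • Matrix.diagonal fun _ => v := by
      ext i
      exact i.elim0
    rw [h, N.smul, norm_zero, zero_mul]
    exact N.nonneg _ _
  | succ n ih =>
    have h : (Matrix.diagonal fun _ : Fin (n + 1) => v)
        = blockSum (Matrix.diagonal fun _ : Fin n => v) (Matrix.of fun _ _ : Fin 1 => v) := by
      ext i j
      refine Fin.addCases (fun i => ?_) (fun i => ?_) i <;>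
        refine Fin.addCases (fun j => ?_) (fun j => ?_) j
      · rw [blockSum_ll]
        simp [Matrix.diagonal_apply]
      · rw [blockSum_lr, Matrix.diagonal_apply_ne]
        exact fun e => i.2.not_ge (by simpa using (Fin.ext_iff.1 e).ge.trans' (Nat.le_add_right n j))
      · rw [blockSum_rl, Matrix.diagonal_apply_ne]
        exact fun e => j.2.not_ge (by simpa using (Fin.ext_iff.1 e).le.trans' (Nat.le_add_right n i))
      · rw [blockSum_rr]
        simp [Subsingleton.elim i j]
    rw [h, N.ruan_sum]
    exact max_le ih le_rfl

/-- The triangle inequality. The infimum over an empty set of costs is the junk value `0`, whence the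
hypotheses, and the first conclusion for iterating. -/
theorem opProjNorm_add_le {n : ℕ} (u u' : Matrix (Fin n) (Fin n) (V ⊗[ℂ] W))
    (hu : (opProjCosts N.mnorm M.mnorm n u).Nonempty)
    (hu' : (opProjCosts N.mnorm M.mnorm n u').Nonempty) :
    (opProjCosts N.mnorm M.mnorm n (u + u')).Nonempty ∧
    opProjNorm N.mnorm M.mnorm n (u + u')
      ≤ opProjNorm N.mnorm M.mnorm n u + opProjNorm N.mnorm M.mnorm n u' := by
  have key : ∀ ε > 0, ∃ y ∈ opProjCosts N.mnorm M.mnorm n (u + u'),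
      y ≤ opProjNorm N.mnorm M.mnorm n u + opProjNorm N.mnorm M.mnorm n u' + ε := by
    intro ε hε
    obtain ⟨a, ha, hax⟩ := exists_lt_of_csInf_lt hu
      (lt_add_of_pos_right (sInf _) (half_pos hε))
    obtain ⟨b, hb, hby⟩ := exists_lt_of_csInf_lt hu'
      (lt_add_of_pos_right (sInf _) (half_pos hε))
    obtain ⟨c, hc, hcr⟩ := opProjCosts_add N M ha hax hb hby
    exact ⟨c, hc, hcr.trans (by simp only [opProjNorm]; linarith)⟩
  refine ⟨let ⟨y, hy, _⟩ := key 1 one_pos; ⟨y, hy⟩, le_of_forall_pos_le_add fun ε hε => ?_⟩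
  obtain ⟨y, hy, h⟩ := key ε hε
  exact (opProjNorm_le N M hy).trans h

/-- The matrix `c ⊗ (v ⊗ w)` is represented as `c ((v ⊗ 1ₙ) ⊗ w) 1`, so its cost is bounded
independently of the size `n`. -/
theorem mem_opProjCosts_smul_tmul {n : ℕ} (c : Matrix (Fin n) (Fin n) ℂ) (v : V) (w : W) :
    ∃ r ∈ opProjCosts N.mnorm M.mnorm n (c.map fun z => z • (v ⊗ₜ[ℂ] w)),
      r ≤ scalarNorm c * (N.mnorm 1 (Matrix.of fun _ _ => v)
        * M.mnorm 1 (Matrix.of fun _ _ => w)) := by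
  let α : Matrix (Fin n) (Fin n × Fin 1) ℂ := Matrix.of fun i x => c i x.1
  let β : Matrix (Fin n × Fin 1) (Fin n) ℂ := Matrix.of fun x j => if x.1 = j then 1 else 0
  have hα : scalarNorm α ≤ scalarNorm c := by
    refine scalarNorm_le_of_sum_norm_sq_le _ (scalarNorm_nonneg c) fun x => ?_
    convert sum_norm_sq_mulVec_le c (fun a => x (a, 0)) using 4
    · simp [α, Matrix.mulVec, dotProduct, Fintype.sum_prod_type]
    · simp [Fintype.sum_prod_type]
  have hβ : scalarNorm β ≤ 1 := by
    refine scalarNorm_le_of_sum_norm_sq_le _ zero_le_one fun x => ?_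
    simp [β, Matrix.mulVec, dotProduct, Fintype.sum_prod_type]
  refine ⟨_, ⟨n, 1, Matrix.diagonal fun _ => v, Matrix.of fun _ _ => w, α, β, ?_, rfl⟩, ?_⟩
  · ext i j
    simp only [compress, tensorMatrix, α, β, Matrix.of_apply, Matrix.map_apply,
      Fintype.sum_prod_type, Matrix.diagonal_apply]
    simp [ite_tmul, Finset.sum_ite_eq]
  · have h1 := mnorm_diagonal_le N v n
    have nβ := scalarNorm_nonneg β
    have nc := scalarNorm_nonneg c
    have nv := N.nonneg n (Matrix.diagonal fun _ => v)
    have nv1 := N.nonneg 1 (Matrix.of fun _ _ => v)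
    have nw := M.nonneg 1 (Matrix.of fun _ _ => w)
    calc _ ≤ scalarNorm c * N.mnorm 1 (Matrix.of fun _ _ => v)
          * M.mnorm 1 (Matrix.of fun _ _ => w) * 1 := by gcongr
      _ = _ := by ring

end Functionals

section FiniteRank

variable {V W X : Type*} [AddCommGroup V] [Module ℂ V] [AddCommGroup W] [Module ℂ W]
  [AddCommGroup X] [Module ℂ X]

/-- A finite rank map `x ↦ ∑ φ s x • (v s ⊗ w s)` with bounded functionals `φ s` is completely
bounded. -/
theorem isCompletelyBounded_of_finiteRank (L : OperatorSpaceStructure X)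
    (N : OperatorSpaceStructure V) (M : OperatorSpaceStructure W) {ι : Type*} (F : Finset ι)
    (φ : ι → X →ₗ[ℂ] ℂ) (hφ : ∀ s, ∃ K, 0 ≤ K ∧
      ∀ x, ‖φ s x‖ ≤ K * L.mnorm 1 (Matrix.of fun _ _ => x))
    (v : ι → V) (w : ι → W) (T : X →ₗ[ℂ] CompletedTensor (opProjSeminorm N M))
    (hT : ∀ x, T x = toCompleted _ (∑ s ∈ F, φ s x • (v s ⊗ₜ[ℂ] w s))) :
    IsCompletelyBounded L N M T := by
  classical
  choose K hK hφK using hφ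
  let C : ι → ℝ := fun s => K s * (N.mnorm 1 (Matrix.of fun _ _ => v s)
    * M.mnorm 1 (Matrix.of fun _ _ => w s))
  refine ⟨∑ s ∈ F, C s, fun n x => ?_⟩
  let u : Finset ι → Matrix (Fin n) (Fin n) (V ⊗[ℂ] W) := fun F =>
    x.map fun y => ∑ s ∈ F, φ s y • (v s ⊗ₜ[ℂ] w s)
  have key : ∀ F : Finset ι, (opProjCosts N.mnorm M.mnorm n (u F)).Nonempty ∧
      opProjNorm N.mnorm M.mnorm n (u F) ≤ (∑ s ∈ F, C s) * L.mnorm n x := by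
    intro F
    induction F using Finset.induction_on with
    | empty =>
      obtain ⟨r, hr, hr0⟩ := mem_opProjCosts_smul_tmul N M (0 : Matrix (Fin n) (Fin n) ℂ) 0 0
      have e : u ∅ = (0 : Matrix (Fin n) (Fin n) ℂ).map fun z => z • ((0 : V) ⊗ₜ[ℂ] (0 : W)) := by
        ext i j
        simp [u]
      have hz : scalarNorm (0 : Matrix (Fin n) (Fin n) ℂ) = 0 := by simp [scalarNorm]
      rw [hz, zero_mul] at hr0
      rw [e]
      exact ⟨⟨r, hr⟩, (opProjNorm_le N M hr).trans (by simpa using hr0)⟩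
    | insert s F hs ih =>
      obtain ⟨r, hr, hrle⟩ := mem_opProjCosts_smul_tmul N M (x.map (φ s)) (v s) (w s)
      have e : u (insert s F) = ((x.map (φ s)).map fun z => z • (v s ⊗ₜ[ℂ] w s)) + u F := by
        ext i j
        simp [u, Finset.sum_insert hs]
      obtain ⟨h1, h2⟩ := opProjNorm_add_le N M _ _ ⟨r, hr⟩ ih.1
      rw [e]
      refine ⟨h1, h2.trans ?_⟩
      rw [Finset.sum_insert hs, add_mul]
      refine add_le_add ((opProjNorm_le N M hr).trans (hrle.trans ?_)) ih.2
      have := scalarNorm_map_functional_le L (φ s) (hK s) (hφK s) n x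
      have nv := N.nonneg 1 (Matrix.of fun _ _ => v s)
      have nw := M.nonneg 1 (Matrix.of fun _ _ => w s)
      calc _ ≤ K s * L.mnorm n x * (N.mnorm 1 (Matrix.of fun _ _ => v s)
            * M.mnorm 1 (Matrix.of fun _ _ => w s)) := by gcongr
        _ = _ := by ring
  have hC : 0 ≤ ∑ s ∈ F, C s := Finset.sum_nonneg fun s _ =>
    mul_nonneg (hK s) (mul_nonneg (N.nonneg _ _) (M.nonneg _ _))
  refine csInf_le ⟨0, fun _ h => h.1⟩ ⟨mul_nonneg hC (L.nonneg n x), subset_closure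
    ⟨u F, (key F).2, ?_⟩⟩
  ext i j
  exact (hT _).symm

end FiniteRank

/-! ### Functionals on completed tensor products -/

section Extension

variable {V W : Type*} [AddCommGroup V] [Module ℂ V] [AddCommGroup W] [Module ℂ W]

theorem denseRange_toCompleted (p : Seminorm ℂ (V ⊗[ℂ] W)) : DenseRange (toCompleted p) :=
  UniformSpace.Completion.denseRange_coe (α := SeminormedTensor p)

theorem norm_toCompleted (p : Seminorm ℂ (V ⊗[ℂ] W)) (t : V ⊗[ℂ] W) :
    ‖toCompleted p t‖ = p t :=
  UniformSpace.Completion.norm_coe (E := SeminormedTensor p) t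

theorem toCompleted_sum_smul (p : Seminorm ℂ (V ⊗[ℂ] W)) {ι : Type*} (F : Finset ι) (c : ι → ℂ)
    (t : ι → V ⊗[ℂ] W) :
    toCompleted p (∑ s ∈ F, c s • t s) = ∑ s ∈ F, c s • toCompleted p (t s) := by
  let g : V ⊗[ℂ] W →ₗ[ℂ] CompletedTensor p :=
    (UniformSpace.Completion.toComplL (𝕜 := ℂ) (E := SeminormedTensor p)).toLinearMap
  change g _ = ∑ s ∈ F, c s • g (t s)
  rw [map_sum]
  exact Finset.sum_congr rfl fun s _ => map_smul g _ _

/-- A functional bounded for `p` extends to the completion, with the same bound. -/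
theorem exists_functional_extension (p : Seminorm ℂ (V ⊗[ℂ] W)) (g : V ⊗[ℂ] W →ₗ[ℂ] ℂ) {C : ℝ}
    (hg : ∀ t, ‖g t‖ ≤ C * p t) :
    ∃ Φ : CompletedTensor p →L[ℂ] ℂ, (∀ t, Φ (toCompleted p t) = g t) ∧ ∀ m, ‖Φ m‖ ≤ C * ‖m‖ := by
  let f : SeminormedTensor p →L[ℂ] ℂ :=
    LinearMap.mkContinuous (show SeminormedTensor p →ₗ[ℂ] ℂ from g) C hg
  have hΦ : ∀ t, f.extend UniformSpace.Completion.toComplL (toCompleted p t) = g t := fun t =>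
    f.extend_eq UniformSpace.Completion.denseRange_coe
      (UniformSpace.Completion.isUniformInducing_coe _) t
  refine ⟨_, hΦ, fun m => ?_⟩
  refine isClosed_property (denseRange_toCompleted p)
    (p := fun m => ‖f.extend UniformSpace.Completion.toComplL m‖ ≤ C * ‖m‖)
    (isClosed_le (ContinuousLinearMap.continuous _).norm (continuous_norm.const_mul C))
    (fun t => ?_) m
  rw [hΦ, norm_toCompleted]
  exact hg t

end Extension

/-! ### Coefficient functions of the left regular representation -/

section Fourier

variable {G : Type u} [Group G] [TopologicalSpace G] [IsTopologicalGroup G]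
  [LocallyCompactSpace G] [MeasurableSpace G] [BorelSpace G]

theorem norm_leftRegular_le (s : G) : ‖leftRegular s‖ ≤ 1 :=
  LinearIsometry.norm_toContinuousLinearMap_le _

theorem continuous_leftRegular_apply (ξ : HaarL2 G) : Continuous fun s : G => leftRegular s ξ := by
  let g : G → C(G, G) := fun s => ⟨fun t => s⁻¹ * t, continuous_const_mul _⟩
  have hg : Continuous g := ContinuousMap.continuous_of_continuous_uncurry _ <| by
    change Continuous fun x : G × G => x.1⁻¹ * x.2
    fun_prop
  exact (continuous_const (y := ξ)).compMeasurePreservingLp hg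
    (fun s => measurePreserving_mul_left Measure.haar s⁻¹) (by norm_num)

/-- The vector functional `T ↦ ⟨T ξ, η⟩` on `VN(G)`. -/
noncomputable def vectorFunctional (ξ η : HaarL2 G) : VN G →L[ℂ] ℂ :=
  LinearMap.mkContinuous
    { toFun := fun T => ⟪η, T.op ξ⟫_ℂ
      map_add' := fun S T => inner_add_right η (S.op ξ) (T.op ξ)
      map_smul' := fun c T => inner_smul_right η (T.op ξ) c } (‖η‖ * ‖ξ‖) fun T => by
    calc ‖⟪η, T.op ξ⟫_ℂ‖ ≤ ‖η‖ * (‖T.op‖ * ‖ξ‖) :=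
          (norm_inner_le_norm _ _).trans
            (mul_le_mul_of_nonneg_left (T.op.le_opNorm ξ) (norm_nonneg _))
      _ = ‖η‖ * ‖ξ‖ * ‖T‖ := by
          change _ = ‖η‖ * ‖ξ‖ * ‖T.op‖
          ring

theorem vectorFunctional_apply (ξ η : HaarL2 G) (T : VN G) :
    vectorFunctional ξ η T = ⟪η, T.op ξ⟫_ℂ := rfl

theorem norm_vectorFunctional_le (ξ η : HaarL2 G) : ‖vectorFunctional ξ η‖ ≤ ‖η‖ * ‖ξ‖ :=
  LinearMap.mkContinuous_norm_le _ (by positivity) _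

theorem vectorFunctional_mem (ξ η : HaarL2 G) : vectorFunctional ξ η ∈ groupVNPredual G :=
  Submodule.le_topologicalClosure _ (Submodule.subset_span ⟨ξ, η, fun _ => rfl⟩)

theorem functionOf_vectorFunctional (ξ η : HaarL2 G) (s : G) :
    functionOf G (vectorFunctional ξ η) s = ⟪η, leftRegular s ξ⟫_ℂ := rfl

theorem vectorFunctional_sub_left (ξ ξ' η : HaarL2 G) :
    vectorFunctional (ξ - ξ') η = vectorFunctional ξ η - vectorFunctional ξ' η :=
  ContinuousLinearMap.ext fun T => by
    simp [vectorFunctional_apply, inner_sub_right]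

theorem vectorFunctional_sub_right (ξ η η' : HaarL2 G) :
    vectorFunctional ξ (η - η') = vectorFunctional ξ η - vectorFunctional ξ η' :=
  ContinuousLinearMap.ext fun T => by
    simp [vectorFunctional_apply, inner_sub_left]

theorem continuous_vectorFunctional_left (η : HaarL2 G) :
    Continuous fun ξ => vectorFunctional ξ η :=
  (LipschitzWith.of_dist_le_mul (K := ‖η‖₊) fun ξ ξ' => by
    rw [dist_eq_norm, dist_eq_norm, ← vectorFunctional_sub_left]
    exact norm_vectorFunctional_le _ _).continuous

theorem continuous_vectorFunctional_right (ξ : HaarL2 G) :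
    Continuous fun η => vectorFunctional ξ η :=
  (LipschitzWith.of_dist_le_mul (K := ‖ξ‖₊) fun η η' => by
    rw [dist_eq_norm, dist_eq_norm, ← vectorFunctional_sub_right, mul_comm]
    exact norm_vectorFunctional_le _ _).continuous

theorem dense_toLp_hasCompactSupport [DiscreteTopology G] :
    Dense {ξ : HaarL2 G | ∃ (g : G → ℂ) (hg : MemLp g 2 Measure.haar),
      HasCompactSupport g ∧ hg.toLp g = ξ} := by
  intro ξ
  refine Metric.mem_closure_iff.2 fun ε hε => ?_
  obtain ⟨g, hc, hle, -, hg⟩ := (Lp.memLp ξ).exists_hasCompactSupport_eLpNorm_sub_le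
    (by norm_num) (ε := ENNReal.ofReal (ε / 2)) (by simpa using hε)
  refine ⟨hg.toLp g, ⟨g, hg, hc, rfl⟩, ?_⟩
  have h : ξ - hg.toLp g = ((Lp.memLp ξ).sub hg).toLp (⇑ξ - g) := by
    rw [MemLp.toLp_sub (Lp.memLp ξ) hg, Lp.toLp_coeFn]
  rw [dist_eq_norm, h, Lp.norm_toLp]
  exact (ENNReal.toReal_le_of_le_ofReal (by positivity) hle).trans_lt (half_lt_self hε)

theorem inner_leftRegular_toLp_eq_zero {g h : G → ℂ} (hg : MemLp g 2 (Measure.haar : Measure G))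
    (hh : MemLp h 2 (Measure.haar : Measure G)) {s : G} (hs : ∀ t, h t = 0 ∨ g (s⁻¹ * t) = 0) :
    ⟪hh.toLp h, leftRegular s (hg.toLp g)⟫_ℂ = 0 := by
  rw [L2.inner_def]
  refine integral_eq_zero_of_ae ?_
  have hp := hg.comp_measurePreserving (measurePreserving_mul_left Measure.haar s⁻¹)
  have e : leftRegular s (hg.toLp g) = hp.toLp _ := Lp.toLp_compMeasurePreserving _ _
  rw [e]
  filter_upwards [hp.coeFn_toLp, hh.coeFn_toLp] with t ht ht'
  rw [ht, ht']
  rcases hs t with h0 | h0 <;> simp [h0]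

/-- A closed subspace of the dual of `VN(G)` that contains the vector functionals contains the
predual. -/
theorem groupVNPredual_le {F : Submodule ℂ (VN G →L[ℂ] ℂ)} (hF : IsClosed (F : Set (VN G →L[ℂ] ℂ)))
    (h : ∀ ξ η : HaarL2 G, vectorFunctional ξ η ∈ F) : groupVNPredual G ≤ F := by
  refine Submodule.topologicalClosure_minimal _ (Submodule.span_le.2 ?_) hF
  rintro φ ⟨ξ, η, hφ⟩
  have : φ = vectorFunctional ξ η := ContinuousLinearMap.ext hφ
  exact this ▸ h ξ η

theorem norm_functionOf_le (φ : VN G →L[ℂ] ℂ) (s : G) : ‖functionOf G φ s‖ ≤ ‖φ‖ := by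
  refine (φ.le_opNorm _).trans (mul_le_of_le_one_right (norm_nonneg _) ?_)
  exact norm_leftRegular_le s

/-- Functions in the Fourier algebra are continuous. -/
theorem continuous_of_mem_fourierAlgebra {a : G → ℂ} (ha : a ∈ fourierAlgebra G) :
    Continuous a := by
  obtain ⟨φ, hφ, rfl⟩ := ha
  let F : Submodule ℂ (VN G →L[ℂ] ℂ) :=
    { carrier := {φ | Continuous (functionOf G φ)}
      add_mem' := fun {a b} ha hb => by
        simp only [Set.mem_ofPred_eq, map_add] at *
        exact ha.add hb
      zero_mem' := by
        simp only [Set.mem_ofPred_eq, map_zero]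
        exact continuous_zero
      smul_mem' := fun c a ha => by
        simp only [Set.mem_ofPred_eq, map_smul] at *
        exact ha.const_smul c }
  refine groupVNPredual_le (F := F) ?_ (fun ξ η => ?_) hφ
  · refine isClosed_of_closure_subset fun φ hφ => ?_
    refine continuous_of_uniform_approx_of_continuous fun u hu => ?_
    obtain ⟨ε, hε, hεu⟩ := Metric.mem_uniformity_dist.1 hu
    obtain ⟨ψ, hψ, hd⟩ := Metric.mem_closure_iff.1 hφ ε hε
    refine ⟨functionOf G ψ, hψ, fun s => hεu ?_⟩
    rw [dist_eq_norm, ← Pi.sub_apply, ← map_sub]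
    exact (norm_functionOf_le _ s).trans_lt (by rwa [← dist_eq_norm])
  · change Continuous (functionOf G _)
    change Continuous fun s => ⟪η, leftRegular s ξ⟫_ℂ
    exact continuous_const.inner (continuous_leftRegular_apply ξ)

theorem fourierNorm_functionOf_le {φ : VN G →L[ℂ] ℂ} (hφ : φ ∈ groupVNPredual G) :
    fourierNorm (functionOf G φ) ≤ ‖φ‖ :=
  csInf_le ⟨0, by rintro _ ⟨ψ, -, -, rfl⟩; exact norm_nonneg _⟩ ⟨φ, hφ, rfl, rfl⟩

theorem norm_apply_le_fourierNorm {a : G → ℂ} (ha : a ∈ fourierAlgebra G) (s : G) :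
    ‖a s‖ ≤ fourierNorm a := by
  obtain ⟨φ, hφ, rfl⟩ := ha
  refine le_csInf ⟨_, φ, hφ, rfl, rfl⟩ ?_
  rintro _ ⟨ψ, -, h, rfl⟩
  rw [← h]
  exact norm_functionOf_le ψ s

/-- The Fourier algebra is regular at points: some function in it is non-zero at `s` and vanishes
off a given neighbourhood of `s`. -/
theorem exists_mem_fourierAlgebra_support_subset (s : G) {U : Set G} (hU : U ∈ 𝓝 s) :
    ∃ a ∈ fourierAlgebra G, a s ≠ 0 ∧ ∀ t ∉ U, a t = 0 := by
  -- Choose an open `V ∋ 1` with `s V V⁻¹ ⊆ U`; the function is `t ↦ |s V ∩ t V|`.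
  have h1 : Tendsto (fun x : G × G => s * x.1 * x.2⁻¹) (𝓝 1 ×ˢ 𝓝 1) (𝓝 s) := by
    have : Continuous fun x : G × G => s * x.1 * x.2⁻¹ := by fun_prop
    simpa [nhds_prod_eq] using this.tendsto (1, 1)
  obtain ⟨V₁, hV₁, hV₁U⟩ := mem_prod_same_iff.1 (h1 hU)
  obtain ⟨V₂, hV₂, hfin⟩ := (Measure.haar : Measure G).finiteAt_nhds 1
  obtain ⟨V, hV, hVo, h1V⟩ := mem_nhds_iff.1 (inter_mem hV₁ hV₂)
  have hVfin : (Measure.haar : Measure G) V ≠ ⊤ :=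
    ((measure_mono fun x hx => (hV hx).2).trans_lt hfin).ne
  have hpre : ∀ t : G, MeasurableSet ((fun x : G => t⁻¹ * x) ⁻¹' V) := fun t =>
    (hVo.preimage (continuous_const_mul _)).measurableSet
  have hμ : ∀ t : G, (Measure.haar : Measure G) ((fun x : G => t⁻¹ * x) ⁻¹' V) = Measure.haar V :=
    fun t => measure_preimage_mul _ _ _
  let ξ : HaarL2 G := indicatorConstLp 2 hVo.measurableSet hVfin 1
  have hξ : ∀ t : G, leftRegular t ξ
      = indicatorConstLp 2 (hpre t) (by rw [hμ]; exact hVfin) 1 := fun t =>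
    Lp.indicatorConstLp_compMeasurePreserving _ _ _ _
  have hval : ∀ t, functionOf G (vectorFunctional ξ (leftRegular s ξ)) t
      = ((Measure.haar : Measure G).real
          ((fun x : G => s⁻¹ * x) ⁻¹' V ∩ (fun x : G => t⁻¹ * x) ⁻¹' V) : ℂ) := by
    intro t
    rw [functionOf_vectorFunctional, hξ, hξ]
    exact L2.inner_indicatorConstLp_one_indicatorConstLp_one (hpre s) (hpre t) _ _
  refine ⟨_, ⟨_, vectorFunctional_mem ξ (leftRegular s ξ), rfl⟩, ?_, fun t ht => ?_⟩
  · rw [hval, Set.inter_self, measureReal_def, hμ, Complex.ofReal_ne_zero]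
    exact ENNReal.toReal_ne_zero.2 ⟨(hVo.measure_pos _ ⟨1, h1V⟩).ne', hVfin⟩
  · rw [hval]
    have : (fun x : G => s⁻¹ * x) ⁻¹' V ∩ (fun x : G => t⁻¹ * x) ⁻¹' V = ∅ := by
      refine Set.eq_empty_of_forall_notMem fun x hx => ht ?_
      have := @hV₁U (s⁻¹ * x, t⁻¹ * x) ⟨(hV hx.1).1, (hV hx.2).1⟩
      simpa using this
    simp [this]

/-- Over a discrete group, the finitely supported functions are dense in the Fourier algebra:
coefficient functions of finitely supported vectors are finitely supported. -/
theorem exists_finite_support_fourierNorm_sub_lt [DiscreteTopology G] {a : G → ℂ}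
    (ha : a ∈ fourierAlgebra G) {ε : ℝ} (hε : 0 < ε) :
    ∃ b ∈ fourierAlgebra G, b.support.Finite ∧ fourierNorm (a - b) < ε := by
  obtain ⟨φ, hφ, rfl⟩ := ha
  let F : Submodule ℂ (VN G →L[ℂ] ℂ) :=
    { carrier := {φ | φ ∈ groupVNPredual G ∧ (functionOf G φ).support.Finite}
      add_mem' := fun {a b} ha hb => ⟨add_mem ha.1 hb.1, by
        rw [map_add]
        exact (ha.2.union hb.2).subset (Function.support_add _ _)⟩
      zero_mem' := ⟨zero_mem _, by simp⟩
      smul_mem' := fun c a ha => ⟨Submodule.smul_mem _ c ha.1, by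
        rw [map_smul]
        exact ha.2.subset (Function.support_const_smul_subset c _)⟩ }
  have hcl : φ ∈ F.topologicalClosure := by
    refine groupVNPredual_le F.isClosed_topologicalClosure (fun ξ η => ?_) hφ
    refine isClosed_property dense_toLp_hasCompactSupport.denseRange_val
      (p := fun ξ => vectorFunctional ξ η ∈ F.topologicalClosure)
      (F.isClosed_topologicalClosure.preimage (continuous_vectorFunctional_left η)) ?_ ξ
    rintro ⟨_, g, hg, hgc, rfl⟩
    refine isClosed_property dense_toLp_hasCompactSupport.denseRange_val
      (p := fun η => vectorFunctional (hg.toLp g) η ∈ F.topologicalClosure)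
      (F.isClosed_topologicalClosure.preimage (continuous_vectorFunctional_right _)) ?_ η
    rintro ⟨_, h, hh, hhc, rfl⟩
    refine F.le_topologicalClosure ⟨vectorFunctional_mem _ _, ?_⟩
    -- The coefficient function vanishes off `(supp h) (supp g)⁻¹`.
    refine ((hhc.isCompact.finite_of_discrete.image2 (fun x y => x * y⁻¹)
      hgc.isCompact.finite_of_discrete)).subset fun s hs => ?_
    by_contra hns
    refine hs (inner_leftRegular_toLp_eq_zero hg hh fun t => ?_)
    by_contra! hne
    exact hns ⟨t, subset_tsupport _ hne.1, s⁻¹ * t, subset_tsupport _ hne.2, by simp⟩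
  obtain ⟨ψ, hψ, hd⟩ := Metric.mem_closure_iff.1 hcl ε hε
  refine ⟨functionOf G ψ, ⟨ψ, hψ.1, rfl⟩, hψ.2, ?_⟩
  rw [← map_sub]
  exact (fourierNorm_functionOf_le (sub_mem hφ hψ.1)).trans_lt (by rwa [← dist_eq_norm])

end Fourier

namespace SegalAlgebra

/-! ### Point evaluations on a Segal algebra -/

variable {G : Type u} [Group G] [TopologicalSpace G] [IsTopologicalGroup G]
  [LocallyCompactSpace G] [MeasurableSpace G] [BorelSpace G] (S : SegalAlgebra G)

/-- Evaluation at a point of the group, a character of the Segal algebra. -/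
def eval (s : G) : S.Space →ₗ[ℂ] ℂ where
  toFun b := (b.1 : G → ℂ) s
  map_add' _ _ := rfl
  map_smul' _ _ := rfl

@[simp]
theorem eval_mul (s : G) (a b : S.Space) : S.eval s (S.mul a b) = S.eval s a * S.eval s b := rfl

variable {S} in
theorem ext_eval {a b : S.Space} (h : ∀ s, S.eval s a = S.eval s b) : a = b :=
  Subtype.ext (funext h)

theorem exists_norm_mul_le : ∃ K, 0 ≤ K ∧ ∀ a b : S.Space, ‖S.mul a b‖ ≤ K * ‖a‖ * ‖b‖ := by
  obtain ⟨π, hπ, -⟩ := S.exists_productMap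
  refine ⟨‖π‖, norm_nonneg _, fun a b => ?_⟩
  have h := π.le_opNorm (toCompleted S.proj (a ⊗ₜ[ℂ] b))
  rw [hπ, TensorProduct.lift.tmul, norm_toCompleted] at h
  refine h.trans ?_
  rw [mul_assoc]
  refine mul_le_mul_of_nonneg_left (sInf_projCosts_le ?_) (norm_nonneg _)
  exact ⟨1, fun _ => a, fun _ => b, by simp, by simp⟩

/-- Point evaluations are uniformly bounded, as characters of a Banach algebra. -/
theorem exists_norm_eval_le : ∃ K, 0 ≤ K ∧ ∀ s (b : S.Space), ‖S.eval s b‖ ≤ K * ‖b‖ := by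
  obtain ⟨K, hK, hmul⟩ := S.exists_norm_mul_le
  refine ⟨K, hK, fun s b => ?_⟩
  by_contra! hlt
  have hne : S.eval s b ≠ 0 := norm_pos_iff.1 ((mul_nonneg hK (norm_nonneg b)).trans_lt hlt)
  -- Normalized to `c s = 1`, the element `c` has `K ‖c‖ < 1`, so `x - c x = c` has a solution,
  -- which is absurd at `s`.
  let c : S.Space := (S.eval s b)⁻¹ • b
  have hc : S.eval s c = 1 := by simp [c, hne]
  have hcn : K * ‖c‖ < 1 := by
    rw [norm_smul, norm_inv, mul_left_comm, inv_mul_lt_one₀ (norm_pos_iff.2 hne)]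
    exact hlt
  let L : S.Space →L[ℂ] S.Space := (S.mul c).mkContinuous (K * ‖c‖) (hmul c)
  have hL : ‖L‖ < 1 :=
    (LinearMap.mkContinuous_norm_le _ (mul_nonneg hK (norm_nonneg c)) _).trans_lt hcn
  obtain ⟨u, hu⟩ := isUnit_one_sub_of_norm_lt_one hL
  have hx : (1 - L) ((↑u⁻¹ : S.Space →L[ℂ] S.Space) c) = c := by
    rw [← hu, ← mul_apply_eq_comp, Units.mul_inv, one_apply_eq_self]
  set x := (↑u⁻¹ : S.Space →L[ℂ] S.Space) c
  have h : S.eval s (x - S.mul c x) = S.eval s c := congrArg (S.eval s) hx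
  rw [map_sub, eval_mul, hc, one_mul, sub_self] at h
  exact zero_ne_one h

theorem continuous_eval (b : S.Space) : Continuous fun s => S.eval s b :=
  continuous_of_mem_fourierAlgebra (S.le_fourier b.2)

theorem continuous_tensorFunctional_eval (s : G) (x : S.Space ⊗[ℂ] S.Space) :
    Continuous fun t => tensorFunctional (S.eval s) (S.eval t) x := by
  induction x using TensorProduct.induction_on with
  | zero =>
    simp only [map_zero]
    exact continuous_const
  | tmul v w =>
    simp only [tensorFunctional_tmul]
    exact (S.continuous_eval w).const_mul _
  | add x y hx hy =>
    simp only [map_add]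
    exact hx.add hy

/-- A Segal algebra is regular at points, by multiplying a function in the Fourier algebra with
small support into the ideal. -/
theorem exists_eval_ne_zero_support_subset (s : G) {U : Set G} (hU : U ∈ 𝓝 s) :
    ∃ b : S.Space, S.eval s b ≠ 0 ∧ ∀ t ∉ U, S.eval t b = 0 := by
  obtain ⟨a, ha, has, haU⟩ := exists_mem_fourierAlgebra_support_subset s hU
  obtain ⟨b, hb, hab⟩ := S.dense a ha _ (norm_pos_iff.2 has)
  have hbs : b s ≠ 0 := by
    intro h0
    have := norm_apply_le_fourierNorm (sub_mem ha (S.le_fourier hb)) s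
    rw [Pi.sub_apply, h0, sub_zero] at this
    exact this.not_gt hab
  exact ⟨⟨a * b, S.mul_mem a ha b hb⟩, mul_ne_zero has hbs, fun t ht => by
    change a t * b t = 0
    rw [haU t ht, zero_mul]⟩

/-! ### Discreteness from a commuting element -/

/-- A commuting element `m` of the completed tensor product, viewed as a function on `G × G` that is
continuous in each variable, is supported on the diagonal, where it equals `c = π(m)`. Hence the
points where `c` does not vanish are isolated. -/
theorem discreteTopology_of_leftAct_eq_rightAct [T2Space G] (p : Seminorm ℂ (S.Space ⊗[ℂ] S.Space))
    {C : ℝ} (hp : ∀ s t x, ‖tensorFunctional (S.eval s) (S.eval t) x‖ ≤ C * p x)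
    (hl : ∀ a t, leftAct S.mul p a (toCompleted p t)
      = toCompleted p ((S.mul a).rTensor S.Space t))
    (hr : ∀ a t, rightAct S.mul p a (toCompleted p t)
      = toCompleted p ((S.mul.flip a).lTensor S.Space t))
    {m : CompletedTensor p} (hm : ∀ a, leftAct S.mul p a m = rightAct S.mul p a m)
    {c : S.Space} (hmc : IsProduct S.mul p m c) (hc : c ≠ 0) : DiscreteTopology G := by
  choose Φ hΦ hΦC using fun s t => exists_functional_extension p _ (hp s t)
  have hleft : ∀ s t a, Φ s t (leftAct S.mul p a m) = S.eval s a * Φ s t m := by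
    intro s t a
    refine isClosed_property (denseRange_toCompleted p)
      (p := fun m => Φ s t (leftAct S.mul p a m) = S.eval s a * Φ s t m)
      (isClosed_eq ((Φ s t).continuous.comp (extendMap_continuous _ _))
        ((Φ s t).continuous.const_mul _)) (fun x => ?_) m
    rw [hl, hΦ, hΦ]
    induction x using TensorProduct.induction_on with
    | zero => simp
    | tmul v w => simp [mul_assoc]
    | add x y hx hy => rw [map_add, map_add, map_add, hx, hy, mul_add]
  have hright : ∀ s t a, Φ s t (rightAct S.mul p a m) = S.eval t a * Φ s t m := by
    intro s t a
    refine isClosed_property (denseRange_toCompleted p)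
      (p := fun m => Φ s t (rightAct S.mul p a m) = S.eval t a * Φ s t m)
      (isClosed_eq ((Φ s t).continuous.comp (extendMap_continuous _ _))
        ((Φ s t).continuous.const_mul _)) (fun x => ?_) m
    rw [hr, hΦ, hΦ]
    induction x using TensorProduct.induction_on with
    | zero => simp
    | tmul v w => simp [mul_left_comm, _root_.mul_comm]
    | add x y hx hy => rw [map_add, map_add, map_add, hx, hy, mul_add]
  have hoff : ∀ s t, s ≠ t → Φ s t m = 0 := by
    intro s t hst
    obtain ⟨a, has, hat⟩ := S.exists_eval_ne_zero_support_subset s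
      (isOpen_compl_singleton.mem_nhds hst : {t}ᶜ ∈ 𝓝 s)
    have h := congrArg (Φ s t) (hm a)
    rw [hleft, hright, hat t (by simp), zero_mul] at h
    exact (mul_eq_zero.1 h).resolve_left has
  obtain ⟨K, hK, hKeval⟩ := S.exists_norm_eval_le
  have hdiag : ∀ s, Φ s s m = S.eval s c := by
    intro s
    have hev : Continuous (S.eval s) :=
      (AddMonoidHomClass.lipschitz_of_bound (S.eval s) K (hKeval s)).continuous
    have hcl : IsClosed {x : CompletedTensor p × S.Space | Φ s s x.1 = S.eval s x.2} :=
      isClosed_eq ((Φ s s).continuous.comp continuous_fst) (hev.comp continuous_snd)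
    refine closure_minimal ?_ hcl hmc
    rintro _ ⟨t, rfl⟩
    change Φ s s (toCompleted p t) = S.eval s (TensorProduct.lift S.mul t)
    rw [hΦ]
    induction t using TensorProduct.induction_on with
    | zero => simp
    | tmul v w => simp
    | add x y hx hy => rw [map_add, map_add, map_add, hx, hy]
  have hcont : ∀ s, Continuous fun t => Φ s t m := by
    intro s
    refine continuous_of_uniform_approx_of_continuous fun u hu => ?_
    obtain ⟨ε, hε, hεu⟩ := Metric.mem_uniformity_dist.1 hu
    have hC : 0 < |C| + 1 := by positivity
    obtain ⟨x, hx⟩ := (denseRange_toCompleted p).exists_dist_lt m (div_pos hε hC)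
    refine ⟨fun t => Φ s t (toCompleted p x), ?_, fun t => hεu ?_⟩
    · simp only [hΦ]
      exact S.continuous_tensorFunctional_eval s x
    · rw [dist_eq_norm, ← map_sub]
      rw [dist_eq_norm, lt_div_iff₀ hC] at hx
      refine (hΦC s t _).trans_lt (lt_of_le_of_lt ?_ hx)
      rw [_root_.mul_comm C]
      exact mul_le_mul_of_nonneg_left ((le_abs_self C).trans (by simp)) (norm_nonneg _)
  obtain ⟨s, hs⟩ : ∃ s, S.eval s c ≠ 0 := by
    by_contra! h
    exact hc (ext_eval fun s => by rw [h, map_zero])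
  have hopen : IsOpen {s} := by
    convert (isOpen_compl_singleton (x := (0 : ℂ))).preimage (hcont s)
    ext t
    constructor
    · rintro rfl
      simpa [hdiag] using hs
    · intro ht
      by_contra hts
      exact ht (hoff s t (Ne.symm hts))
  refine discreteTopology_of_isOpen_singleton_one ?_
  convert hopen.preimage (continuous_const_mul s)
  ext t
  simp

variable [DiscreteTopology G]

/-! ### Segal algebras over discrete groups -/

/-- The indicator function of a point of a discrete group, as an element of the Segal algebra. -/
noncomputable def single (s : G) : S.Space :=
  let b := (S.exists_eval_ne_zero_support_subset s (U := {s}) (by simp)).choose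
  (S.eval s b)⁻¹ • b

open scoped Classical in
@[simp]
theorem eval_single (s t : G) : S.eval t (S.single s) = if t = s then 1 else 0 := by
  have h := (S.exists_eval_ne_zero_support_subset s (U := {s}) (by simp)).choose_spec
  rw [single, map_smul, smul_eq_mul]
  split_ifs with hts
  · rw [hts, inv_mul_cancel₀ h.1]
  · rw [h.2 t hts, mul_zero]

@[simp]
theorem mul_single (a : S.Space) (s : G) : S.mul a (S.single s) = S.eval s a • S.single s := by
  classical
  refine ext_eval fun t => ?_
  by_cases h : t = s <;> simp [h]

/-- Over a discrete group, the finitely supported functions are dense in a Segal algebra, by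
essentiality and their density in the Fourier algebra. -/
theorem exists_finite_support_norm_sub_lt (b : S.Space) {ε : ℝ} (hε : 0 < ε) :
    ∃ f : S.Space, (Function.support fun s => S.eval s f).Finite ∧ ‖b - f‖ < ε := by
  let F : Submodule ℂ S.Space :=
    { carrier := {f | (Function.support fun s => S.eval s f).Finite}
      add_mem' := fun {a b} ha hb => by
        refine (Set.Finite.union ha hb).subset fun s hs => ?_
        by_contra! h
        simp only [Set.mem_union, Function.mem_support, not_or, not_not] at h
        exact hs (by simp [h.1, h.2])
      zero_mem' := by simp
      smul_mem' := fun c a ha => by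
        refine Set.Finite.subset ha fun s hs => ?_
        by_contra h
        simp only [Function.mem_support, not_not] at h
        exact hs (by simp [h]) }
  have hspan : Submodule.span ℂ (Set.range fun x : fourierAlgebra G × S.carrier =>
      pointwiseAction (fourierAlgebra G) S.carrier S.mul_mem x.1 x.2)
      ≤ (show Submodule ℂ S.carrier from F.topologicalClosure) := by
    refine Submodule.span_le.2 ?_
    rintro _ ⟨⟨a, c⟩, rfl⟩
    let act : fourierAlgebra G → S.Space := fun a =>
      pointwiseAction (fourierAlgebra G) S.carrier S.mul_mem a c
    change act a ∈ closure (F : Set S.Space)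
    refine Metric.mem_closure_iff.2 fun δ hδ => ?_
    have hc : 0 < S.nrm c + 1 := by have := S.nrm_nonneg c; positivity
    obtain ⟨f, hf, hfin, hlt⟩ := exists_finite_support_fourierNorm_sub_lt a.2 (div_pos hδ hc)
    refine ⟨act ⟨f, hf⟩, hfin.subset fun s hs => ?_, ?_⟩
    · exact left_ne_zero_of_mul (show f s * (c : G → ℂ) s ≠ 0 from hs)
    · have e : act a - act ⟨f, hf⟩ = act (a - ⟨f, hf⟩) := by
        simp only [act, map_sub, LinearMap.sub_apply]
        rfl
      rw [dist_eq_norm, e]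
      refine (S.contractive (a - ⟨f, hf⟩) c).trans_lt ?_
      rw [lt_div_iff₀ hc] at hlt
      refine lt_of_le_of_lt ?_ hlt
      refine mul_le_mul_of_nonneg_left (by simp) (fourierNorm_nonneg _)
  obtain ⟨c, hc, hbc⟩ : ∃ c ∈ F.topologicalClosure, ‖b - c‖ < ε / 2 :=
    let ⟨c, hc, hbc⟩ := S.essential b (ε / 2) (half_pos hε)
    ⟨c, hspan hc, hbc⟩
  obtain ⟨f, hf, hcf⟩ := Metric.mem_closure_iff.1 hc (ε / 2) (half_pos hε)
  refine ⟨f, hf, ?_⟩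
  rw [dist_eq_norm] at hcf
  have h := norm_sub_le_norm_sub_add_norm_sub b c f
  linarith

/-- An approximate identity of a Segal algebra over a discrete group can be replaced by a finitely
supported one. -/
theorem exists_finite_support_approximateIdentity (h : HasApproximateIdentity S.mul) :
    ∃ (Λ : Type u) (_ : Nonempty Λ) (_ : Preorder Λ) (_ : IsDirectedOrder Λ) (f : Λ → S.Space),
      (∀ l, (Function.support fun s => S.eval s (f l)).Finite) ∧
      ∀ a, Tendsto (fun l => S.mul (f l) a) atTop (𝓝 a) := by
  obtain ⟨Λ, hne, hpre, hdir, e, he⟩ := h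
  obtain ⟨K, hK, hmul⟩ := S.exists_norm_mul_le
  choose f hf hfe using fun l : Λ × ℕ =>
    S.exists_finite_support_norm_sub_lt (e l.1) (Nat.one_div_pos_of_nat (α := ℝ) (n := l.2))
  have hdir' : IsDirectedOrder (Λ × ℕ) := ⟨fun x y =>
    let ⟨z, hx, hy⟩ := exists_ge_ge x.1 y.1
    ⟨(z, max x.2 y.2), ⟨hx, le_max_left _ _⟩, ⟨hy, le_max_right _ _⟩⟩⟩
  refine ⟨Λ × ℕ, inferInstance, inferInstance, hdir', f, hf, fun a => ?_⟩
  have h1 : Tendsto (fun l : Λ × ℕ => S.mul (e l.1) a) atTop (𝓝 a) := by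
    rw [← prod_atTop_atTop_eq]
    exact (he a).1.comp tendsto_fst
  have h2 : Tendsto (fun l : Λ × ℕ => S.mul (e l.1 - f l) a) atTop (𝓝 0) := by
    refine squeeze_zero_norm (a := fun l : Λ × ℕ => K * (1 / ((l.2 : ℝ) + 1)) * ‖a‖)
      (fun l => (hmul _ _).trans ?_) ?_
    · have := (hfe l).le
      gcongr
    · rw [← prod_atTop_atTop_eq]
      have := (tendsto_one_div_add_atTop_nhds_zero_nat (𝕜 := ℝ)).comp
        (tendsto_snd (f := (atTop : Filter Λ)) (g := (atTop : Filter ℕ)))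
      simpa using (this.const_mul K).mul_const ‖a‖
  simpa using h1.sub h2

/-- The element `∑ c s • (δ_s ⊗ δ_s)` of the algebraic tensor product, supported on a finite part of
the diagonal. -/
noncomputable def diagonalTensor (F : Finset G) (c : G → ℂ) : S.Space ⊗[ℂ] S.Space :=
  ∑ s ∈ F, c s • (S.single s ⊗ₜ[ℂ] S.single s)

theorem rTensor_diagonalTensor (a : S.Space) (F : Finset G) (c : G → ℂ) :
    (S.mul a).rTensor S.Space (S.diagonalTensor F c)
      = S.diagonalTensor F fun s => S.eval s a * c s := by
  simp [diagonalTensor, TensorProduct.smul_tmul', smul_smul, _root_.mul_comm]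

theorem lTensor_diagonalTensor (a : S.Space) (F : Finset G) (c : G → ℂ) :
    (S.mul.flip a).lTensor S.Space (S.diagonalTensor F c)
      = S.diagonalTensor F fun s => S.eval s a * c s := by
  have h : ∀ s, S.mul (S.single s) a = S.eval s a • S.single s := fun s => by
    rw [S.mul_comm, mul_single]
  simp [diagonalTensor, h, smul_smul, _root_.mul_comm]

theorem lift_diagonalTensor {F : Finset G} (f : S.Space)
    (hf : ∀ s ∉ F, S.eval s f = 0) :
    TensorProduct.lift S.mul (S.diagonalTensor F fun s => S.eval s f) = f := by
  classical
  refine ext_eval fun t => ?_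
  simp only [diagonalTensor, map_sum, map_smul, TensorProduct.lift.tmul, eval_mul, eval_single,
    smul_eq_mul]
  by_cases ht : t ∈ F
  · simp [ht]
  · simp [ht, hf t ht]

theorem pseudoContractible_of_discreteTopology (p : Seminorm ℂ (S.Space ⊗[ℂ] S.Space))
    (hl : ∀ a t, leftAct S.mul p a (toCompleted p t)
      = toCompleted p ((S.mul a).rTensor S.Space t))
    (hr : ∀ a t, rightAct S.mul p a (toCompleted p t)
      = toCompleted p ((S.mul.flip a).lTensor S.Space t))
    (h : HasApproximateIdentity S.mul) : PseudoContractible S.mul p := by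
  obtain ⟨Λ, hne, hpre, hdir, f, hf, hlim⟩ := S.exists_finite_support_approximateIdentity h
  refine ⟨Λ, hne, hpre, hdir,
    fun l => toCompleted p (S.diagonalTensor (hf l).toFinset fun s => S.eval s (f l)), f,
    fun l => subset_closure ⟨_, Prod.ext rfl (S.lift_diagonalTensor _ ?_)⟩, fun l a => ?_, hlim⟩
  · simp
  · rw [hl, hr, rTensor_diagonalTensor, lTensor_diagonalTensor]

/-- The approximating bimodule maps are `a ↦ a · m` for the diagonal elements `m` of a finitely
supported approximate identity; these maps have finite rank. -/
theorem approximatelyBiprojective_of_discreteTopology (p : Seminorm ℂ (S.Space ⊗[ℂ] S.Space))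
    (hl : ∀ a t, leftAct S.mul p a (toCompleted p t)
      = toCompleted p ((S.mul a).rTensor S.Space t))
    (hr : ∀ a t, rightAct S.mul p a (toCompleted p t)
      = toCompleted p ((S.mul.flip a).lTensor S.Space t))
    {Admissible : (S.Space →L[ℂ] CompletedTensor p) → Prop}
    (hadm : ∀ (T : S.Space →L[ℂ] CompletedTensor p) (F : Finset G) (c : G → ℂ),
      (∀ a, T a = toCompleted p (S.diagonalTensor F fun s => S.eval s a * c s)) → Admissible T)
    (h : HasApproximateIdentity S.mul) : ApproximatelyBiprojective S.mul p Admissible := by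
  obtain ⟨Λ, hne, hpre, hdir, f, hf, hlim⟩ := S.exists_finite_support_approximateIdentity h
  obtain ⟨K, hK, hKeval⟩ := S.exists_norm_eval_le
  let T : Λ → S.Space →L[ℂ] CompletedTensor p := fun l => ∑ s ∈ (hf l).toFinset,
    ((S.eval s).mkContinuous K (hKeval s)).smulRight
      (S.eval s (f l) • toCompleted p (S.single s ⊗ₜ[ℂ] S.single s))
  have hT : ∀ l a, T l a = toCompleted p
      (S.diagonalTensor (hf l).toFinset fun s => S.eval s a * S.eval s (f l)) := by
    intro l a
    rw [diagonalTensor, toCompleted_sum_smul]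
    simp [T, smul_smul]
  refine ⟨Λ, hne, hpre, hdir, T, fun l a => S.mul a (f l), fun l => hadm _ _ _ (hT l),
    fun l a b => ⟨?_, ?_⟩, fun l a => ?_, fun a => ?_⟩
  · rw [hT, hT, hl, rTensor_diagonalTensor]
    simp only [eval_mul, mul_assoc]
  · rw [hT, hT, hr, lTensor_diagonalTensor]
    simp only [eval_mul, mul_assoc, mul_left_comm]
  · rw [hT]
    refine subset_closure ⟨_, Prod.ext rfl (S.lift_diagonalTensor (S.mul a (f l)) fun s hs => ?_)⟩
    have : S.eval s (f l) = 0 := by simpa using hs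
    rw [eval_mul, this, mul_zero]
  · simpa only [S.mul_comm a] using hlim a

end SegalAlgebra

/-! ### Pseudo-contractibility, approximate biprojectivity and discreteness -/

namespace SegalAlgebra

variable {G : Type u} [Group G] [TopologicalSpace G] [IsTopologicalGroup G]
  [LocallyCompactSpace G] [MeasurableSpace G] [BorelSpace G] (S : SegalAlgebra G)

theorem exists_ne_zero : ∃ b : S.Space, b ≠ 0 := by
  obtain ⟨b, hb, -⟩ := S.exists_eval_ne_zero_support_subset 1 univ_mem
  exact ⟨b, fun h => hb (by rw [h, map_zero])⟩

variable {S} in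
theorem hasApproximateIdentity_of_pseudoContractible {p : Seminorm ℂ (S.Space ⊗[ℂ] S.Space)}
    (h : PseudoContractible S.mul p) : HasApproximateIdentity S.mul := by
  obtain ⟨Λ, hne, hpre, hdir, m, c, -, -, hlim⟩ := h
  exact ⟨Λ, hne, hpre, hdir, c, fun a => ⟨hlim a, by simpa only [S.mul_comm a] using hlim a⟩⟩

/-- The equivalence for a seminorm on the algebraic tensor product for which the module actions and
the functionals `δ_s ⊗ δ_t` are bounded, and for which the finite rank maps with values in the
diagonal are admissible. -/
theorem tfae_of_seminorm [T2Space G] (p : Seminorm ℂ (S.Space ⊗[ℂ] S.Space))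
    {C : ℝ} (hp : ∀ s t x, ‖tensorFunctional (S.eval s) (S.eval t) x‖ ≤ C * p x)
    (hl : ∀ a t, leftAct S.mul p a (toCompleted p t)
      = toCompleted p ((S.mul a).rTensor S.Space t))
    (hr : ∀ a t, rightAct S.mul p a (toCompleted p t)
      = toCompleted p ((S.mul.flip a).lTensor S.Space t))
    {Admissible : (S.Space →L[ℂ] CompletedTensor p) → Prop}
    (hadm : ∀ [DiscreteTopology G] (T : S.Space →L[ℂ] CompletedTensor p) (F : Finset G) (c : G → ℂ),
      (∀ a, T a = toCompleted p (S.diagonalTensor F fun s => S.eval s a * c s)) → Admissible T) :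
    List.TFAE [
      HasApproximateIdentity S.mul ∧ DiscreteTopology G,
      HasApproximateIdentity S.mul ∧ ApproximatelyBiprojective S.mul p Admissible,
      PseudoContractible S.mul p] := by
  obtain ⟨a, ha⟩ := S.exists_ne_zero
  tfae_have 1 → 2 := fun ⟨h, _⟩ =>
    ⟨h, S.approximatelyBiprojective_of_discreteTopology p hl hr hadm h⟩
  tfae_have 1 → 3 := fun ⟨h, _⟩ => S.pseudoContractible_of_discreteTopology p hl hr h
  tfae_have 2 → 1 := by
    rintro ⟨h, Λ, hne, hpre, hdir, T, c, -, hT, hc, hlim⟩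
    obtain ⟨l, hla⟩ := ((hlim a).eventually_ne ha).exists
    -- The product is commutative, so each value of a bimodule map is a commuting element.
    refine ⟨h, S.discreteTopology_of_leftAct_eq_rightAct p hp hl hr (fun b => ?_) (hc l a) hla⟩
    rw [← (hT l b a).1, ← (hT l b a).2, S.mul_comm]
  tfae_have 3 → 1 := by
    intro h
    refine ⟨hasApproximateIdentity_of_pseudoContractible h, ?_⟩
    obtain ⟨Λ, hne, hpre, hdir, m, c, hc, hm, hlim⟩ := h
    obtain ⟨l, hla⟩ := ((hlim a).eventually_ne ha).exists
    exact S.discreteTopology_of_leftAct_eq_rightAct p hp hl hr (hm l) (hc l)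
      fun h0 => hla (by rw [h0, map_zero, LinearMap.zero_apply])
  tfae_finish

end SegalAlgebra

theorem OperatorSegalAlgebra.opStructure_mnorm_one {G : Type u} [Group G] [TopologicalSpace G]
    [IsTopologicalGroup G] [LocallyCompactSpace G] [MeasurableSpace G] [BorelSpace G]
    (S : OperatorSegalAlgebra G) (b : S.Space) :
    S.opStructure.mnorm 1 (Matrix.of fun _ _ => b) = ‖b‖ :=
  S.mnorm_one b

theorem mainTheorem8 {G : Type u} [Group G] [TopologicalSpace G] [IsTopologicalGroup G]
    [LocallyCompactSpace G] [T2Space G] [MeasurableSpace G] [BorelSpace G] :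
    (∀ S : SegalAlgebra G, List.TFAE [
      HasApproximateIdentity S.mul ∧ DiscreteTopology G,
      HasApproximateIdentity S.mul ∧ S.IsApproximatelyBiprojective,
      S.IsPseudoContractible]) ∧
    (∀ S : OperatorSegalAlgebra G, List.TFAE [
      HasApproximateIdentity S.mul ∧ DiscreteTopology G,
      HasApproximateIdentity S.mul ∧ S.IsOperatorApproximatelyBiprojective,
      S.IsOperatorPseudoContractible]) := by
  refine ⟨fun S => ?_, fun S => ?_⟩
  · obtain ⟨K, hK, hKeval⟩ := S.exists_norm_eval_le
    exact S.tfae_of_seminorm S.proj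
      (fun s t => norm_tensorFunctional_le_projSeminorm _ _ hK hK (hKeval s) (hKeval t))
      S.leftAct_coe S.rightAct_coe (fun _ _ _ _ => trivial)
  · obtain ⟨K, hK, hKeval⟩ := S.exists_norm_eval_le
    have hK1 : ∀ s b, ‖S.eval s b‖ ≤ K * S.opStructure.mnorm 1 (Matrix.of fun _ _ => b) :=
      fun s b => by rw [S.opStructure_mnorm_one]; exact hKeval s b
    refine S.tfae_of_seminorm S.opProj
      (fun s t => norm_tensorFunctional_le_opProjSeminorm _ _ _ _ hK hK (hK1 s) (hK1 t))
      S.leftAct_coe S.rightAct_coe (fun T F c hT => ?_)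
    refine isCompletelyBounded_of_finiteRank _ _ _ F (fun s => c s • S.eval s)
      (fun s => ⟨‖c s‖ * K, mul_nonneg (norm_nonneg _) hK, fun b => ?_⟩) S.single S.single _
      fun b => ?_
    · rw [LinearMap.smul_apply, norm_smul, mul_assoc]
      exact mul_le_mul_of_nonneg_left (hK1 s b) (norm_nonneg _)
    · refine (hT b).trans ?_
      simp only [SegalAlgebra.diagonalTensor, LinearMap.smul_apply, smul_eq_mul, mul_comm]
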